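/- A *prop* is a strict symmetric monoidal category whose objects are the natural numbers, with addition as tensor product of objects; a morphism of props is a strict symmetric monoidal functor that is the identity on objects. Composition is written in diagrammatic order, $\sigma$ is the symmetry $2\to 2$ of two single wires, and $\mathrm{id}_n$ is the identity on $n$. Let $\mathsf{Iso}(\mathsf{cb}_2)$ be the prop generated by one map $c:2\to 2$ (the controlled-not gate, control on the left wire, target on the right wire). Write $c'=\sigma;c;\sigma$ and, for $g : 2\to 2$, $g_{12}=g\otimes \mathrm{id}_1$, $g_{23}=\mathrm{id}_1\otimes g$ and $g_{13}=\sigma_{23};g_{12};\sigma_{23}$. The relations are $$c;c=\mathrm{id}_2,\quad c';c;c'=\sigma,\quad c_{23};c_{12};c_{23}=c_{12};c_{13},\quad c_{12};c'_{23}=c'_{23};c_{12},\quad c'_{12};c_{23}=c_{23};c'_{12}.$$ Let $\mathsf{Mono}(\mathsf{cb}_2)$ be the prop obtained from $\mathsf{Iso}(\mathsf{cb}_2)$ by adjoining a generator $u:0\to 1$ and the relation $(u\otimes \mathrm{id}_1);c=u\otimes \mathrm{id}_1$. Let $\mathsf{Iso}(\mathsf{Affcb}_2)$ be the prop obtained from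 $\mathsf{Iso}(\mathsf{cb}_2)$ by adjoining a generator $\nu:1\to 1$ (the not gate) and the relations $$\nu;\nu=\mathrm{id}_1,\quad (\nu\otimes \mathrm{id}_1);c=c;(\nu\otimes\nu),\quad (\mathrm{id}_1\otimes\nu);c=c;(\mathrm{id}_1\otimes\nu).$$ Let $\mathsf{Mono}(\mathsf{Affcb}_2)$ be the pushout, in the category of props, of the canonical morphisms $\mathsf{Mono}(\mathsf{cb}_2)\leftarrow\mathsf{Iso}(\mathsf{cb}_2)\to\mathsf{Iso}(\mathsf{Affcb}_2)$. Let $(\mathsf{AffMat}(\mathbb F_2),+)$ be the prop whose maps $n\to m$ are the pairs $(A,x)$ of a matrix $A\in\mathbb F_2^{m\times n}$ and a vector $x\in\mathbb F_2^m$, representing the affine map $v\mapsto Av+x$, with $(A,x);(B,y)=(BA,Bx+y)$ and with the direct sum as tensor product. Let $(\mathsf{Mono}(\mathsf{AffMat}(\mathbb F_2)),+)$ be its sub-prop of monomorphisms. **Lemma.** $\mathsf{Mono}(\mathsf{Affcb}_2)$ is a presentation of the prop $(\mathsf{Mono}(\mathsf{AffMat}(\mathbb F_2)),+)$: there is an isomorphism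 of props $\mathsf{Mono}(\mathsf{Affcb}_2)\cong(\mathsf{Mono}(\mathsf{AffMat}(\mathbb F_2)),+)$ whose composites with the two coprojections of the pushout are the interpretation morphisms of $\mathsf{Mono}(\mathsf{cb}_2)$ and $\mathsf{Iso}(\mathsf{Affcb}_2)$ given by $c\mapsto\big((a,b)\mapsto(a,a+b)\big)$, $u\mapsto 0\in\mathbb F_2^1$ and $\nu\mapsto(a\mapsto a+1)$. -/

import Mathlib

open CategoryTheory

/-! ### Props -/

/-- Transport of an element of an `ℕ × ℕ`-indexed family along equalities of the indices. -/
def castHom {H : ℕ → ℕ → Type} {a b a' b' : ℕ} (ha : a = a') (hb : b = b') (f : H a b) :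
    H a' b' :=
  hb ▸ ha ▸ f

@[simp] theorem castHom_rfl {H : ℕ → ℕ → Type} {a b : ℕ} (ha : a = a) (hb : b = b) (f : H a b) :
    castHom ha hb f = f := rfl

theorem castHom_map {H K : ℕ → ℕ → Type} (φ : ∀ {a b : ℕ}, H a b → K a b) {a b a' b' : ℕ}
    (ha : a = a') (hb : b = b') (f : H a b) :
    φ (castHom ha hb f) = castHom ha hb (φ f) := by
  subst ha; subst hb; rfl

/-- A prop: a strict symmetric monoidal category whose objects are the natural numbers, with
tensor product of objects given by addition. Composition is written in diagrammatic order.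
Equations between maps whose (co)domains are only propositionally equal use `castHom`. -/
structure PROP where
  Hom : ℕ → ℕ → Type
  id : ∀ a : ℕ, Hom a a
  comp : ∀ {a b c : ℕ}, Hom a b → Hom b c → Hom a c
  tensor : ∀ {a b c d : ℕ}, Hom a b → Hom c d → Hom (a + c) (b + d)
  symm : ∀ a b : ℕ, Hom (a + b) (b + a)
  id_comp : ∀ {a b : ℕ} (f : Hom a b), comp (id a) f = f
  comp_id : ∀ {a b : ℕ} (f : Hom a b), comp f (id b) = f
  assoc : ∀ {a b c d : ℕ} (f : Hom a b) (g : Hom b c) (h : Hom c d),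
    comp (comp f g) h = comp f (comp g h)
  tensor_id : ∀ a b : ℕ, tensor (id a) (id b) = id (a + b)
  tensor_comp : ∀ {a b c a' b' c' : ℕ} (f : Hom a b) (g : Hom b c) (f' : Hom a' b')
    (g' : Hom b' c'), tensor (comp f g) (comp f' g') = comp (tensor f f') (tensor g g')
  tensor_assoc : ∀ {a b a' b' a'' b'' : ℕ} (f : Hom a b) (g : Hom a' b') (h : Hom a'' b''),
    castHom (Nat.add_assoc a a' a'') (Nat.add_assoc b b' b'') (tensor (tensor f g) h) =
      tensor f (tensor g h)
  unit_tensor : ∀ {a b : ℕ} (f : Hom a b),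
    castHom (Nat.zero_add a) (Nat.zero_add b) (tensor (id 0) f) = f
  tensor_unit : ∀ {a b : ℕ} (f : Hom a b),
    castHom (Nat.add_zero a) (Nat.add_zero b) (tensor f (id 0)) = f
  symm_natural : ∀ {a b c d : ℕ} (f : Hom a b) (g : Hom c d),
    comp (tensor f g) (symm b d) = comp (symm a c) (tensor g f)
  symm_symm : ∀ a b : ℕ, comp (symm a b) (symm b a) = id (a + b)
  hexagon : ∀ a b c : ℕ,
    castHom (Nat.add_assoc a b c).symm rfl (symm a (b + c)) =
      comp (tensor (symm a b) (id c))
        (castHom (Nat.add_assoc b a c).symm (Nat.add_assoc b c a).symm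
          (tensor (id b) (symm a c)))

namespace PROP

/-- A morphism of props: a strict symmetric monoidal functor that is the identity on objects. -/
@[ext]
structure Morphism (P Q : PROP) where
  map : ∀ {a b : ℕ}, P.Hom a b → Q.Hom a b
  map_id : ∀ a : ℕ, map (P.id a) = Q.id a
  map_comp : ∀ {a b c : ℕ} (f : P.Hom a b) (g : P.Hom b c),
    map (P.comp f g) = Q.comp (map f) (map g)
  map_tensor : ∀ {a b c d : ℕ} (f : P.Hom a b) (g : P.Hom c d),
    map (P.tensor f g) = Q.tensor (map f) (map g)
  map_symm : ∀ a b : ℕ, map (P.symm a b) = Q.symm a b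

/-- The category of props. -/
instance : Category PROP where
  Hom := Morphism
  id P :=
    { map := fun f => f
      map_id := fun _ => rfl
      map_comp := fun _ _ => rfl
      map_tensor := fun _ _ => rfl
      map_symm := fun _ _ => rfl }
  comp F G :=
    { map := fun f => G.map (F.map f)
      map_id := fun a => by rw [F.map_id, G.map_id]
      map_comp := fun f g => by rw [F.map_comp, G.map_comp]
      map_tensor := fun f g => by rw [F.map_tensor, G.map_tensor]
      map_symm := fun a b => by rw [F.map_symm, G.map_symm] }

theorem hom_ext {P Q : PROP} {F G : P ⟶ Q}
    (h : ∀ {a b : ℕ} (f : P.Hom a b), F.map f = G.map f) : F = G := by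
  apply Morphism.ext
  funext a b f
  exact h f

theorem comp_map {P Q R : PROP} (F : P ⟶ Q) (G : Q ⟶ R) {a b : ℕ} (f : P.Hom a b) :
    (F ≫ G).map f = G.map (F.map f) := rfl

/-- Monomorphisms of a prop. -/
def IsMono (P : PROP) {a b : ℕ} (f : P.Hom a b) : Prop :=
  ∀ ⦃k : ℕ⦄ (g h : P.Hom k a), P.comp g f = P.comp h f → g = h

/-- The sub-prop of all monomorphisms of a prop in which the tensor product of two
monomorphisms is a monomorphism. -/
def Mono (P : PROP)
    (hP : ∀ {a b c d : ℕ} (f : P.Hom a b) (g : P.Hom c d),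
      P.IsMono f → P.IsMono g → P.IsMono (P.tensor f g)) : PROP :=
  have hcast : ∀ {a b a' b' : ℕ} (ha : a = a') (hb : b = b') (f : { f : P.Hom a b // P.IsMono f }),
      (castHom (H := fun a b => { f : P.Hom a b // P.IsMono f }) ha hb f).1 =
        castHom ha hb f.1 := by
    intro a b a' b' ha hb f
    exact castHom_map (H := fun a b => { f : P.Hom a b // P.IsMono f }) (K := P.Hom)
      (fun f => f.1) ha hb f
  { Hom := fun a b => { f : P.Hom a b // P.IsMono f }
    id := fun a => ⟨P.id a, fun _ g h e => by simpa only [P.comp_id] using e⟩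
    comp := fun f g => ⟨P.comp f.1 g.1, fun _ h k e => f.2 _ _ (g.2 _ _ (by
      simpa only [P.assoc] using e))⟩
    tensor := fun f g => ⟨P.tensor f.1 g.1, hP f.1 g.1 f.2 g.2⟩
    symm := fun a b => ⟨P.symm a b, fun _ h k e => by
      have := congrArg (fun t => P.comp t (P.symm b a)) e
      simpa only [P.assoc, P.symm_symm, P.comp_id] using this⟩
    id_comp := fun f => Subtype.ext (P.id_comp f.1)
    comp_id := fun f => Subtype.ext (P.comp_id f.1)
    assoc := fun f g h => Subtype.ext (P.assoc f.1 g.1 h.1)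
    tensor_id := fun a b => Subtype.ext (P.tensor_id a b)
    tensor_comp := fun f g f' g' => Subtype.ext (P.tensor_comp f.1 g.1 f'.1 g'.1)
    tensor_assoc := fun f g h => Subtype.ext
      ((hcast _ _ _).trans (P.tensor_assoc f.1 g.1 h.1))
    unit_tensor := fun f => Subtype.ext ((hcast _ _ _).trans (P.unit_tensor f.1))
    tensor_unit := fun f => Subtype.ext ((hcast _ _ _).trans (P.tensor_unit f.1))
    symm_natural := fun f g => Subtype.ext (P.symm_natural f.1 g.1)
    symm_symm := fun a b => Subtype.ext (P.symm_symm a b)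
    hexagon := fun a b c => Subtype.ext ((hcast _ _ _).trans ((P.hexagon a b c).trans
      (congrArg (P.comp (P.tensor (P.symm a b) (P.id c)))
        (hcast (Nat.add_assoc b a c).symm (Nat.add_assoc b c a).symm
          (⟨P.tensor (P.id b) (P.symm a c), _⟩ : { f : P.Hom _ _ // P.IsMono f })).symm))) }

end PROP

/-! ### Symmetric monoidal theories and the props they generate -/

/-- Formal composites and tensor products of generators, identities and symmetries. -/
inductive PropTerm (G : ℕ → ℕ → Type) : ℕ → ℕ → Type
  | gen {a b : ℕ} (g : G a b) : PropTerm G a b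
  | id (a : ℕ) : PropTerm G a a
  | comp {a b c : ℕ} (s : PropTerm G a b) (t : PropTerm G b c) : PropTerm G a c
  | tensor {a b c d : ℕ} (s : PropTerm G a b) (t : PropTerm G c d) : PropTerm G (a + c) (b + d)
  | symm (a b : ℕ) : PropTerm G (a + b) (b + a)

namespace PropTerm

/-- Renaming of generators. -/
def map {G G' : ℕ → ℕ → Type} (φ : ∀ {a b : ℕ}, G a b → G' a b) :
    ∀ {a b : ℕ}, PropTerm G a b → PropTerm G' a b
  | _, _, gen g => gen (φ g)
  | _, _, id a => id a
  | _, _, comp s t => comp (s.map φ) (t.map φ)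
  | _, _, tensor s t => tensor (s.map φ) (t.map φ)
  | _, _, symm a b => symm a b

/-- Value of a term in a prop, given values of the generators. -/
def eval {G : ℕ → ℕ → Type} (P : PROP) (φ : ∀ {a b : ℕ}, G a b → P.Hom a b) :
    ∀ {a b : ℕ}, PropTerm G a b → P.Hom a b
  | _, _, gen g => φ g
  | _, _, id a => P.id a
  | _, _, comp s t => P.comp (s.eval P φ) (t.eval P φ)
  | _, _, tensor s t => P.tensor (s.eval P φ) (t.eval P φ)
  | _, _, symm a b => P.symm a b

theorem eval_map {G G' : ℕ → ℕ → Type} (P : PROP) (ψ : ∀ {a b : ℕ}, G a b → G' a b)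
    (φ : ∀ {a b : ℕ}, G' a b → P.Hom a b) {a b : ℕ} (t : PropTerm G a b) :
    (t.map ψ).eval P φ = t.eval P (fun g => φ (ψ g)) := by
  induction t with
  | gen g => rfl
  | id a => rfl
  | comp s t hs ht => simp only [map, eval, hs, ht]
  | tensor s t hs ht => simp only [map, eval, hs, ht]
  | symm a b => rfl

end PropTerm

/-- A symmetric monoidal theory: typed generators, and equations between parallel terms. -/
structure SMTheory where
  Gen : ℕ → ℕ → Type
  Eqn : ∀ {a b : ℕ}, PropTerm Gen a b → PropTerm Gen a b → Prop

namespace SMTheory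

open PropTerm in
/-- The congruence on terms generated by the equations of the theory and the axioms of a prop. -/
inductive Rel (T : SMTheory) : ∀ {a b : ℕ}, PropTerm T.Gen a b → PropTerm T.Gen a b → Prop
  | eqn {a b : ℕ} {s t : PropTerm T.Gen a b} (h : T.Eqn s t) : Rel T s t
  | refl {a b : ℕ} (s : PropTerm T.Gen a b) : Rel T s s
  | symm {a b : ℕ} {s t : PropTerm T.Gen a b} (h : Rel T s t) : Rel T t s
  | trans {a b : ℕ} {s t u : PropTerm T.Gen a b} (h : Rel T s t) (h' : Rel T t u) : Rel T s u
  | congr_comp {a b c : ℕ} {s s' : PropTerm T.Gen a b} {t t' : PropTerm T.Gen b c}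
      (h : Rel T s s') (h' : Rel T t t') : Rel T (comp s t) (comp s' t')
  | congr_tensor {a b c d : ℕ} {s s' : PropTerm T.Gen a b} {t t' : PropTerm T.Gen c d}
      (h : Rel T s s') (h' : Rel T t t') : Rel T (tensor s t) (tensor s' t')
  | id_comp {a b : ℕ} (f : PropTerm T.Gen a b) : Rel T (comp (id a) f) f
  | comp_id {a b : ℕ} (f : PropTerm T.Gen a b) : Rel T (comp f (id b)) f
  | assoc {a b c d : ℕ} (f : PropTerm T.Gen a b) (g : PropTerm T.Gen b c)
      (h : PropTerm T.Gen c d) : Rel T (comp (comp f g) h) (comp f (comp g h))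
  | tensor_id (a b : ℕ) : Rel T (tensor (id a) (id b)) (id (a + b))
  | tensor_comp {a b c a' b' c' : ℕ} (f : PropTerm T.Gen a b) (g : PropTerm T.Gen b c)
      (f' : PropTerm T.Gen a' b') (g' : PropTerm T.Gen b' c') :
      Rel T (tensor (comp f g) (comp f' g')) (comp (tensor f f') (tensor g g'))
  | tensor_assoc {a b a' b' a'' b'' : ℕ} (f : PropTerm T.Gen a b) (g : PropTerm T.Gen a' b')
      (h : PropTerm T.Gen a'' b'') :
      Rel T (castHom (Nat.add_assoc a a' a'') (Nat.add_assoc b b' b'') (tensor (tensor f g) h))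
        (tensor f (tensor g h))
  | unit_tensor {a b : ℕ} (f : PropTerm T.Gen a b) :
      Rel T (castHom (Nat.zero_add a) (Nat.zero_add b) (tensor (id 0) f)) f
  | tensor_unit {a b : ℕ} (f : PropTerm T.Gen a b) :
      Rel T (castHom (Nat.add_zero a) (Nat.add_zero b) (tensor f (id 0))) f
  | symm_natural {a b c d : ℕ} (f : PropTerm T.Gen a b) (g : PropTerm T.Gen c d) :
      Rel T (comp (tensor f g) (symm b d)) (comp (symm a c) (tensor g f))
  | symm_symm (a b : ℕ) : Rel T (comp (symm a b) (symm b a)) (id (a + b))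
  | hexagon (a b c : ℕ) :
      Rel T (castHom (Nat.add_assoc a b c).symm rfl (symm a (b + c)))
        (comp (tensor (symm a b) (id c))
          (castHom (Nat.add_assoc b a c).symm (Nat.add_assoc b c a).symm
            (tensor (id b) (symm a c))))

/-- Terms modulo the generated congruence. -/
def setoid (T : SMTheory) (a b : ℕ) : Setoid (PropTerm T.Gen a b) where
  r := T.Rel
  iseqv := ⟨Rel.refl, Rel.symm, Rel.trans⟩

/-- The prop generated by a symmetric monoidal theory. -/
def prop (T : SMTheory) : PROP :=
  have hcast : ∀ {a b a' b' : ℕ} (ha : a = a') (hb : b = b') (t : PropTerm T.Gen a b),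
      castHom (H := fun a b => Quotient (T.setoid a b)) ha hb (Quotient.mk (T.setoid a b) t) =
        Quotient.mk (T.setoid a' b') (castHom ha hb t) := by
    intro a b a' b' ha hb t
    subst ha; subst hb; rfl
  { Hom := fun a b => Quotient (T.setoid a b)
    id := fun a => Quotient.mk _ (PropTerm.id a)
    comp := fun f g => Quotient.map₂ PropTerm.comp (fun _ _ h _ _ h' => Rel.congr_comp h h') f g
    tensor := fun f g =>
      Quotient.map₂ PropTerm.tensor (fun _ _ h _ _ h' => Rel.congr_tensor h h') f g
    symm := fun a b => Quotient.mk _ (PropTerm.symm a b)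
    id_comp := by
      rintro a b ⟨f⟩
      exact Quotient.sound (Rel.id_comp f)
    comp_id := by
      rintro a b ⟨f⟩
      exact Quotient.sound (Rel.comp_id f)
    assoc := by
      rintro a b c d ⟨f⟩ ⟨g⟩ ⟨h⟩
      exact Quotient.sound (Rel.assoc f g h)
    tensor_id := fun a b => Quotient.sound (Rel.tensor_id a b)
    tensor_comp := by
      rintro a b c a' b' c' ⟨f⟩ ⟨g⟩ ⟨f'⟩ ⟨g'⟩
      exact Quotient.sound (Rel.tensor_comp f g f' g')
    tensor_assoc := by
      rintro a b a' b' a'' b'' ⟨f⟩ ⟨g⟩ ⟨h⟩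
      exact (hcast _ _ _).trans (Quotient.sound (Rel.tensor_assoc f g h))
    unit_tensor := by
      rintro a b ⟨f⟩
      exact (hcast _ _ _).trans (Quotient.sound (Rel.unit_tensor f))
    tensor_unit := by
      rintro a b ⟨f⟩
      exact (hcast _ _ _).trans (Quotient.sound (Rel.tensor_unit f))
    symm_natural := by
      rintro a b c d ⟨f⟩ ⟨g⟩
      exact Quotient.sound (Rel.symm_natural f g)
    symm_symm := fun a b => Quotient.sound (Rel.symm_symm a b)
    hexagon := fun a b c => by
      refine (hcast _ _ _).trans ((Quotient.sound (Rel.hexagon a b c)).trans ?_)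
      exact congrArg (Quotient.map₂ PropTerm.comp (fun _ _ h _ _ h' => Rel.congr_comp h h')
        (Quotient.mk (T.setoid _ _) (PropTerm.tensor (PropTerm.symm a b) (PropTerm.id c))))
        (hcast (Nat.add_assoc b a c).symm (Nat.add_assoc b c a).symm
          (PropTerm.tensor (PropTerm.id b) (PropTerm.symm a c))).symm }

/-- The map of the generated prop denoted by a term. -/
def ofTerm (T : SMTheory) {a b : ℕ} (t : PropTerm T.Gen a b) : T.prop.Hom a b :=
  Quotient.mk (T.setoid a b) t

theorem ofTerm_eq (T : SMTheory) {a b : ℕ} {s t : PropTerm T.Gen a b} (h : T.Rel s t) :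
    T.ofTerm s = T.ofTerm t :=
  Quotient.sound h

theorem eval_rel (T : SMTheory) (P : PROP) (φ : ∀ {a b : ℕ}, T.Gen a b → P.Hom a b)
    (hφ : ∀ {a b : ℕ} {s t : PropTerm T.Gen a b}, T.Eqn s t → s.eval P φ = t.eval P φ)
    {a b : ℕ} {s t : PropTerm T.Gen a b} (h : T.Rel s t) : s.eval P φ = t.eval P φ := by
  have hcast : ∀ {a b a' b' : ℕ} (ha : a = a') (hb : b = b') (t : PropTerm T.Gen a b),
      (castHom ha hb t).eval P φ = castHom ha hb (t.eval P φ) := by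
    intro a b a' b' ha hb t
    subst ha; subst hb; rfl
  induction h with
  | eqn h => exact hφ h
  | refl s => rfl
  | symm h ih => exact ih.symm
  | trans h h' ih ih' => exact ih.trans ih'
  | congr_comp h h' ih ih' => simp only [PropTerm.eval, ih, ih']
  | congr_tensor h h' ih ih' => simp only [PropTerm.eval, ih, ih']
  | id_comp f => exact P.id_comp _
  | comp_id f => exact P.comp_id _
  | assoc f g h => exact P.assoc _ _ _
  | tensor_id a b => exact P.tensor_id a b
  | tensor_comp f g f' g' => exact P.tensor_comp _ _ _ _
  | tensor_assoc f g h => rw [hcast]; exact P.tensor_assoc _ _ _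
  | unit_tensor f => rw [hcast]; exact P.unit_tensor _
  | tensor_unit f => rw [hcast]; exact P.tensor_unit _
  | symm_natural f g => exact P.symm_natural _ _
  | symm_symm a b => exact P.symm_symm a b
  | hexagon a b c =>
    rw [hcast]
    refine (P.hexagon a b c).trans ?_
    simp only [PropTerm.eval, hcast]

/-- The morphism out of the generated prop determined by values of the generators that satisfy
the equations. -/
def lift (T : SMTheory) (P : PROP) (φ : ∀ {a b : ℕ}, T.Gen a b → P.Hom a b)
    (hφ : ∀ {a b : ℕ} {s t : PropTerm T.Gen a b}, T.Eqn s t → s.eval P φ = t.eval P φ) :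
    T.prop ⟶ P :=
  PROP.Morphism.mk
    (fun f => Quotient.lift (fun t => t.eval P φ) (fun _ _ h => T.eval_rel P φ hφ h) f)
    (fun _ => rfl)
    (by rintro a b c ⟨f⟩ ⟨g⟩; rfl)
    (by rintro a b c d ⟨f⟩ ⟨g⟩; rfl)
    (fun _ _ => rfl)

theorem lift_ofTerm (T : SMTheory) (P : PROP) (φ : ∀ {a b : ℕ}, T.Gen a b → P.Hom a b)
    (hφ : ∀ {a b : ℕ} {s t : PropTerm T.Gen a b}, T.Eqn s t → s.eval P φ = t.eval P φ)
    {a b : ℕ} (t : PropTerm T.Gen a b) : (T.lift P φ hφ).map (T.ofTerm t) = t.eval P φ := rfl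

theorem map_ofTerm (T : SMTheory) {P : PROP} (F : T.prop ⟶ P) {a b : ℕ} (t : PropTerm T.Gen a b) :
    F.map (T.ofTerm t) = t.eval P (fun g => F.map (T.ofTerm (PropTerm.gen g))) := by
  induction t with
  | gen g => rfl
  | id a => exact F.map_id a
  | comp s t hs ht =>
    refine (F.map_comp (T.ofTerm s) (T.ofTerm t)).trans ?_
    rw [hs, ht]; rfl
  | tensor s t hs ht =>
    refine (F.map_tensor (T.ofTerm s) (T.ofTerm t)).trans ?_
    rw [hs, ht]; rfl
  | symm a b => exact F.map_symm a b

theorem prop_hom_ext (T : SMTheory) {P : PROP} {F F' : T.prop ⟶ P}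
    (h : ∀ {a b : ℕ} (g : T.Gen a b),
      F.map (T.ofTerm (PropTerm.gen g)) = F'.map (T.ofTerm (PropTerm.gen g))) : F = F' := by
  apply PROP.hom_ext
  rintro a b ⟨t⟩
  refine (T.map_ofTerm F t).trans (Eq.trans ?_ (T.map_ofTerm F' t).symm)
  congr 1
  funext a b g
  exact h g

/-- The disjoint union of two signatures. -/
abbrev sumGen (G G' : ℕ → ℕ → Type) (a b : ℕ) : Type := G a b ⊕ G' a b

/-- Adjoining generators `G'` and equations `E'` to a theory. -/
inductive ExtendEqn (T : SMTheory) (G' : ℕ → ℕ → Type)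
    (E' : ∀ {a b : ℕ}, PropTerm (sumGen T.Gen G') a b → PropTerm (sumGen T.Gen G') a b → Prop) :
    ∀ {a b : ℕ}, PropTerm (sumGen T.Gen G') a b → PropTerm (sumGen T.Gen G') a b → Prop
  | old {a b : ℕ} {s t : PropTerm T.Gen a b} (h : T.Eqn s t) :
      ExtendEqn T G' E' (s.map (fun g => Sum.inl g)) (t.map (fun g => Sum.inl g))
  | new {a b : ℕ} {s t : PropTerm (sumGen T.Gen G') a b} (h : E' s t) : ExtendEqn T G' E' s t

/-- Adjoining generators `G'` and equations `E'` to a theory. -/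
def extend (T : SMTheory) (G' : ℕ → ℕ → Type)
    (E' : ∀ {a b : ℕ}, PropTerm (sumGen T.Gen G') a b → PropTerm (sumGen T.Gen G') a b → Prop) :
    SMTheory where
  Gen := sumGen T.Gen G'
  Eqn := ExtendEqn T G' E'

theorem eval_gen (T : SMTheory) {a b : ℕ} (t : PropTerm T.Gen a b) :
    t.eval T.prop (fun g => T.ofTerm (PropTerm.gen g)) = T.ofTerm t :=
  (T.map_ofTerm (𝟙 T.prop) t).symm

/-- The canonical morphism from the prop of a theory to the prop of an extended theory. -/
def toExtend (T : SMTheory) (G' : ℕ → ℕ → Type)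
    (E' : ∀ {a b : ℕ}, PropTerm (sumGen T.Gen G') a b → PropTerm (sumGen T.Gen G') a b → Prop) :
    T.prop ⟶ (T.extend G' E').prop :=
  T.lift _ (fun g => (T.extend G' E').ofTerm (PropTerm.gen (Sum.inl g))) (by
    intro a b s t h
    have key : ∀ u : PropTerm T.Gen a b,
        u.eval (T.extend G' E').prop
          (fun g => (T.extend G' E').ofTerm (PropTerm.gen (Sum.inl g))) =
        (T.extend G' E').ofTerm (u.map (fun g => Sum.inl g)) := by
      intro u
      exact (PropTerm.eval_map (T.extend G' E').prop (G' := (T.extend G' E').Gen)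
        (fun g => Sum.inl g) (fun g => (T.extend G' E').ofTerm (PropTerm.gen g)) u).symm.trans
        (eval_gen (T.extend G' E') _)
    rw [key, key]
    exact ofTerm_eq _ (Rel.eqn (ExtendEqn.old h)))

/-- The morphism out of the prop of an extended theory determined by values of the old and of the
new generators. -/
def extendLift (T : SMTheory) (G' : ℕ → ℕ → Type)
    (E' : ∀ {a b : ℕ}, PropTerm (sumGen T.Gen G') a b → PropTerm (sumGen T.Gen G') a b → Prop)
    (P : PROP) (φ : ∀ {a b : ℕ}, T.Gen a b → P.Hom a b) (ψ : ∀ {a b : ℕ}, G' a b → P.Hom a b)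
    (hφ : ∀ {a b : ℕ} {s t : PropTerm T.Gen a b}, T.Eqn s t → s.eval P φ = t.eval P φ)
    (hψ : ∀ {a b : ℕ} {s t : PropTerm (sumGen T.Gen G') a b}, E' s t →
      s.eval P (fun g => Sum.elim φ ψ g) = t.eval P (fun g => Sum.elim φ ψ g)) :
    (T.extend G' E').prop ⟶ P :=
  (T.extend G' E').lift P (fun g => Sum.elim φ ψ g) (by
    intro a b s t h
    cases h with
    | old h =>
      rename_i s t
      exact (PropTerm.eval_map P (G' := sumGen T.Gen G') (fun g => Sum.inl g)
        (fun g => Sum.elim φ ψ g) s).trans ((hφ h).trans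
        (PropTerm.eval_map P (G' := sumGen T.Gen G') (fun g => Sum.inl g)
          (fun g => Sum.elim φ ψ g) t).symm)
    | new h => exact hψ h)

end SMTheory

/-! ### Pushouts of props -/

namespace PROP

/-- The equations of the pushout: both maps into the pushout are morphisms of props, and they
agree on the common prop. -/
inductive PushoutEqn {R P Q : PROP} (F : R ⟶ P) (G : R ⟶ Q) :
    ∀ {a b : ℕ}, PropTerm (SMTheory.sumGen P.Hom Q.Hom) a b →
      PropTerm (SMTheory.sumGen P.Hom Q.Hom) a b → Prop
  | inl_id (a : ℕ) : PushoutEqn F G (.gen (Sum.inl (P.id a))) (.id a)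
  | inl_comp {a b c : ℕ} (f : P.Hom a b) (g : P.Hom b c) :
      PushoutEqn F G (.gen (Sum.inl (P.comp f g))) (.comp (.gen (Sum.inl f)) (.gen (Sum.inl g)))
  | inl_tensor {a b c d : ℕ} (f : P.Hom a b) (g : P.Hom c d) :
      PushoutEqn F G (.gen (Sum.inl (P.tensor f g))) (.tensor (.gen (Sum.inl f)) (.gen (Sum.inl g)))
  | inl_symm (a b : ℕ) : PushoutEqn F G (.gen (Sum.inl (P.symm a b))) (.symm a b)
  | inr_id (a : ℕ) : PushoutEqn F G (.gen (Sum.inr (Q.id a))) (.id a)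
  | inr_comp {a b c : ℕ} (f : Q.Hom a b) (g : Q.Hom b c) :
      PushoutEqn F G (.gen (Sum.inr (Q.comp f g))) (.comp (.gen (Sum.inr f)) (.gen (Sum.inr g)))
  | inr_tensor {a b c d : ℕ} (f : Q.Hom a b) (g : Q.Hom c d) :
      PushoutEqn F G (.gen (Sum.inr (Q.tensor f g))) (.tensor (.gen (Sum.inr f)) (.gen (Sum.inr g)))
  | inr_symm (a b : ℕ) : PushoutEqn F G (.gen (Sum.inr (Q.symm a b))) (.symm a b)
  | glue {a b : ℕ} (f : R.Hom a b) :
      PushoutEqn F G (.gen (Sum.inl (F.map f))) (.gen (Sum.inr (G.map f)))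

/-- The theory generated by all maps of `P` and `Q`, subject to all equations of `P` and `Q` and
to the identification of the images of `R`. -/
def pushoutTheory {R P Q : PROP} (F : R ⟶ P) (G : R ⟶ Q) : SMTheory where
  Gen := SMTheory.sumGen P.Hom Q.Hom
  Eqn := PushoutEqn F G

def pushoutInl {R P Q : PROP} (F : R ⟶ P) (G : R ⟶ Q) : P ⟶ (pushoutTheory F G).prop :=
  Morphism.mk (fun f => (pushoutTheory F G).ofTerm (PropTerm.gen (Sum.inl f)))
    (fun a => SMTheory.ofTerm_eq _ (SMTheory.Rel.eqn (PushoutEqn.inl_id a)))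
    (fun f g => SMTheory.ofTerm_eq _ (SMTheory.Rel.eqn (PushoutEqn.inl_comp f g)))
    (fun f g => SMTheory.ofTerm_eq _ (SMTheory.Rel.eqn (PushoutEqn.inl_tensor f g)))
    (fun a b => SMTheory.ofTerm_eq _ (SMTheory.Rel.eqn (PushoutEqn.inl_symm a b)))

def pushoutInr {R P Q : PROP} (F : R ⟶ P) (G : R ⟶ Q) : Q ⟶ (pushoutTheory F G).prop :=
  Morphism.mk (fun f => (pushoutTheory F G).ofTerm (PropTerm.gen (Sum.inr f)))
    (fun a => SMTheory.ofTerm_eq _ (SMTheory.Rel.eqn (PushoutEqn.inr_id a)))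
    (fun f g => SMTheory.ofTerm_eq _ (SMTheory.Rel.eqn (PushoutEqn.inr_comp f g)))
    (fun f g => SMTheory.ofTerm_eq _ (SMTheory.Rel.eqn (PushoutEqn.inr_tensor f g)))
    (fun a b => SMTheory.ofTerm_eq _ (SMTheory.Rel.eqn (PushoutEqn.inr_symm a b)))

theorem isPushout_pushoutTheory {R P Q : PROP} (F : R ⟶ P) (G : R ⟶ Q) :
    IsPushout F G (pushoutInl F G) (pushoutInr F G) := by
  refine ⟨⟨hom_ext fun f => SMTheory.ofTerm_eq _ (SMTheory.Rel.eqn (PushoutEqn.glue f))⟩, ⟨?_⟩⟩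
  refine Limits.PushoutCocone.IsColimit.mk _
    (fun s => (pushoutTheory F G).lift s.pt
      (fun g => Sum.elim (fun f => s.inl.map f) (fun f => s.inr.map f) g) ?_) ?_ ?_ ?_
  · intro a b u v h
    cases h with
    | inl_id a => exact s.inl.map_id a
    | inl_comp f g => exact s.inl.map_comp f g
    | inl_tensor f g => exact s.inl.map_tensor f g
    | inl_symm a b => exact s.inl.map_symm a b
    | inr_id a => exact s.inr.map_id a
    | inr_comp f g => exact s.inr.map_comp f g
    | inr_tensor f g => exact s.inr.map_tensor f g
    | inr_symm a b => exact s.inr.map_symm a b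
    | glue f => exact congrArg (fun K : R ⟶ s.pt => K.map f) s.condition
  · intro s
    rfl
  · intro s
    rfl
  · intro s m h₁ h₂
    apply SMTheory.prop_hom_ext
    rintro a b (f | f)
    · exact congrArg (fun K : P ⟶ s.pt => K.map f) h₁
    · exact congrArg (fun K : Q ⟶ s.pt => K.map f) h₂

instance : Limits.HasPushouts PROP :=
  @Limits.hasPushouts_of_hasColimit_span PROP _
    (fun {_ _ _ F G} => (isPushout_pushoutTheory F G).hasPushout)

end PROP

/-! ### The prop of affine matrices over the field with two elements -/

/-- An affine matrix `n → m` over `𝔽₂`: the pair `(A, x)` of an `m × n` matrix `A` and a vector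
`x` of length `m`, representing the affine map `v ↦ A v + x`. -/
@[ext]
structure AffMat (n m : ℕ) : Type where
  lin : Matrix (Fin m) (Fin n) (ZMod 2)
  vec : Fin m → ZMod 2

namespace AffMat

open Matrix

/-- The affine map represented by an affine matrix. -/
def app {n m : ℕ} (f : AffMat n m) (v : Fin n → ZMod 2) : Fin m → ZMod 2 := f.lin *ᵥ v + f.vec

def id (n : ℕ) : AffMat n n := ⟨1, 0⟩

def comp {n m k : ℕ} (f : AffMat n m) (g : AffMat m k) : AffMat n k :=
  ⟨g.lin * f.lin, g.lin *ᵥ f.vec + g.vec⟩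

/-- Direct sum. -/
def tensor {n m n' m' : ℕ} (f : AffMat n m) (g : AffMat n' m') : AffMat (n + n') (m + m') :=
  ⟨Matrix.reindex finSumFinEquiv finSumFinEquiv (Matrix.fromBlocks f.lin 0 0 g.lin),
    Fin.append f.vec g.vec⟩

/-- The linear map exchanging two blocks of coordinates. -/
def symm (n m : ℕ) : AffMat (n + m) (m + n) :=
  ⟨Matrix.reindex finSumFinEquiv finSumFinEquiv (Matrix.fromBlocks 0 1 1 0), 0⟩

theorem app_injective {n m : ℕ} {f g : AffMat n m} (h : ∀ v, f.app v = g.app v) : f = g := by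
  have hv : f.vec = g.vec := by simpa [app] using h 0
  have hl : f.lin = g.lin := by
    apply Matrix.toLin'.injective
    apply LinearMap.ext
    intro v
    simpa [app, hv] using h v
  exact AffMat.ext hl hv

theorem app_id {n : ℕ} (v : Fin n → ZMod 2) : (id n).app v = v := by simp [app, id]

theorem app_comp {n m k : ℕ} (f : AffMat n m) (g : AffMat m k) (v : Fin n → ZMod 2) :
    (comp f g).app v = g.app (f.app v) := by
  simp [app, comp, Matrix.mulVec_add, add_assoc]

theorem app_tensor {n m n' m' : ℕ} (f : AffMat n m) (g : AffMat n' m')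
    (v : Fin n → ZMod 2) (w : Fin n' → ZMod 2) :
    (tensor f g).app (Fin.append v w) = Fin.append (f.app v) (g.app w) := by
  funext i
  refine Fin.addCases (fun i => ?_) (fun i => ?_) i <;>
    simp [app, tensor, Matrix.mulVec, dotProduct, Fin.sum_univ_add, ← finSumFinEquiv_apply_left,
      ← finSumFinEquiv_apply_right] <;>
    simp
  all_goals rfl

theorem app_symm {n m : ℕ} (v : Fin n → ZMod 2) (w : Fin m → ZMod 2) :
    (symm n m).app (Fin.append v w) = Fin.append w v := by
  funext i
  refine Fin.addCases (fun i => ?_) (fun i => ?_) i <;>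
    simp [app, symm, Matrix.mulVec, dotProduct, Fin.sum_univ_add, ← finSumFinEquiv_apply_left,
      ← finSumFinEquiv_apply_right] <;>
    simp [Matrix.one_apply]

theorem app_castHom {n m n' m' : ℕ} (hn : n = n') (hm : m = m') (f : AffMat n m)
    (v : Fin n' → ZMod 2) :
    (castHom hn hm f).app v = f.app (v ∘ Fin.cast hn) ∘ Fin.cast hm.symm := by
  subst hn; subst hm; rfl

theorem forall_append {n m : ℕ} {p : (Fin (n + m) → ZMod 2) → Prop}
    (h : ∀ v w, p (Fin.append v w)) (v : Fin (n + m) → ZMod 2) : p v := by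
  rw [← Fin.append_castAdd_natAdd (f := v)]
  exact h _ _

/-- The prop of affine matrices over `𝔽₂`, with the direct sum as tensor product. -/
def prop : PROP where
  Hom := AffMat
  id := id
  comp := comp
  tensor := tensor
  symm := symm
  id_comp f := app_injective fun v => by simp only [app_comp, app_id]
  comp_id f := app_injective fun v => by simp only [app_comp, app_id]
  assoc f g h := app_injective fun v => by simp only [app_comp]
  tensor_id a b := app_injective <| forall_append fun v w => by simp only [app_tensor, app_id]
  tensor_comp f g f' g' := app_injective <| forall_append fun v w => by
    simp only [app_tensor, app_comp]
  tensor_assoc f g h := app_injective <| forall_append fun u => forall_append fun v w => by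
    have e : Fin.append u (Fin.append v w) ∘ Fin.cast (Nat.add_assoc _ _ _) =
        Fin.append (Fin.append u v) w := (Fin.append_assoc u v w).symm
    rw [app_castHom, e]
    rw [app_tensor, app_tensor, app_tensor, app_tensor, Fin.append_assoc]
    rfl
  unit_tensor {a b} f := app_injective fun v => by
    have e : v ∘ Fin.cast (Nat.zero_add a) = Fin.append ![] v := by
      rw [Fin.append_left_nil _ _ rfl]
    rw [app_castHom, e, app_tensor, Fin.append_left_nil _ _ rfl]
    rfl
  tensor_unit {a b} f := app_injective fun v => by
    have e : v ∘ Fin.cast (Nat.add_zero a) = Fin.append v ![] := by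
      rw [Fin.append_right_nil _ _ rfl]
    rw [app_castHom, e, app_tensor, Fin.append_right_nil _ _ rfl]
    rfl
  symm_natural f g := app_injective <| forall_append fun v w => by
    simp only [app_tensor, app_comp, app_symm]
  symm_symm a b := app_injective <| forall_append fun v w => by
    simp only [app_comp, app_symm, app_id]
  hexagon a b c := app_injective <| forall_append <| forall_append fun u v w => by
    have e : Fin.append (Fin.append u v) w ∘ Fin.cast (Nat.add_assoc a b c).symm =
        Fin.append u (Fin.append v w) := by
      rw [Fin.append_assoc]; rfl
    have e' : Fin.append (Fin.append v u) w ∘ Fin.cast (Nat.add_assoc b a c).symm =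
        Fin.append v (Fin.append u w) := by
      rw [Fin.append_assoc]; rfl
    rw [app_castHom, e, app_comp, app_tensor, app_castHom, app_symm, app_symm, app_id, e',
      app_tensor, app_symm, app_id, ← Function.comp_id (Fin.append (Fin.append v w) u),
      Fin.append_assoc]
    rfl

/-- An affine matrix is a monomorphism iff the affine map that it represents is injective. -/
theorem isMono_iff {n m : ℕ} (f : AffMat n m) :
    prop.IsMono f ↔ Function.Injective f.app := by
  constructor
  · intro h v w e
    have key : (⟨0, v⟩ : AffMat 0 n) = ⟨0, w⟩ := by
      refine h (⟨0, v⟩ : AffMat 0 n) (⟨0, w⟩ : AffMat 0 n) (app_injective fun u => ?_)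
      refine (app_comp _ _ _).trans (Eq.trans ?_ (app_comp _ _ _).symm)
      simpa [app] using e
    exact congrArg AffMat.vec key
  · intro h k g g' e
    refine app_injective fun v => h ?_
    have := congrArg (fun t : AffMat k m => t.app v) e
    exact (app_comp g f v).symm.trans (this.trans (app_comp g' f v))

theorem isMono_tensor {a b c d : ℕ} (f : prop.Hom a b) (g : prop.Hom c d)
    (hf : prop.IsMono f) (hg : prop.IsMono g) : prop.IsMono (prop.tensor f g) := by
  have hf' := (isMono_iff f).1 hf
  have hg' := (isMono_iff g).1 hg
  refine (isMono_iff (n := a + c) (m := b + d) (tensor f g)).2 ?_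
  intro v w
  revert v w
  refine forall_append fun v v' => forall_append fun w w' => ?_
  intro e
  replace e := ((app_tensor f g v v').symm.trans e).trans (app_tensor f g w w')
  have h₁ : v = w := hf' (funext fun i => by
    simpa only [Fin.append_left] using congrFun e (Fin.castAdd d i))
  have h₂ : v' = w' := hg' (funext fun i => by
    simpa only [Fin.append_right] using congrFun e (Fin.natAdd b i))
  rw [h₁, h₂]

/-- The controlled-not matrix `(x, y) ↦ (x, x + y)`. -/
def cnot : AffMat 2 2 := ⟨!![1, 0; 1, 1], 0⟩

/-- The not gate `x ↦ x + 1`. -/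
def not : AffMat 1 1 := ⟨1, 1⟩

/-- The zero vector of `𝔽₂`, as a map `0 → 1`. -/
def zero : AffMat 0 1 := ⟨0, 0⟩

theorem isMono_cnot : prop.IsMono cnot := (isMono_iff cnot).2 (by unfold Function.Injective; decide)

theorem isMono_not : prop.IsMono not := (isMono_iff not).2 (by unfold Function.Injective; decide)

theorem isMono_zero : prop.IsMono zero := (isMono_iff zero).2 (by unfold Function.Injective; decide)

end AffMat

/-- The prop `(Mono(AffMat(𝔽₂)), +)`. -/
def MonoAffMat : PROP := AffMat.prop.Mono AffMat.isMono_tensor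

/-! ### The theories -/

/-- The controlled-not gate, from two wires to two wires. -/
inductive CNotGen : ℕ → ℕ → Type
  | cnot : CNotGen 2 2

/-- The black circle, from zero wires to one wire. -/
inductive UnitGen : ℕ → ℕ → Type
  | unit : UnitGen 0 1

/-- The not gate, from one wire to one wire. -/
inductive NotGen : ℕ → ℕ → Type
  | not : NotGen 1 1

namespace Circuit

open PropTerm

variable {G : ℕ → ℕ → Type}

/-- The symmetry of two single wires. -/
def swap : PropTerm G 2 2 := symm 1 1

/-- A two-wire gate with its two wires interchanged. -/
def flip (c : PropTerm G 2 2) : PropTerm G 2 2 := comp swap (comp c swap)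

/-- A two-wire gate on the first and second of three wires. -/
def on12 (c : PropTerm G 2 2) : PropTerm G 3 3 := tensor c (id 1)

/-- A two-wire gate on the second and third of three wires. -/
def on23 (c : PropTerm G 2 2) : PropTerm G 3 3 := tensor (id 1) c

/-- A two-wire gate on the first and third of three wires. -/
def on13 (c : PropTerm G 2 2) : PropTerm G 3 3 := comp (on23 swap) (comp (on12 c) (on23 swap))

/-- The controlled-not gate with its control on the left wire and its target on the right. -/
def cnot : PropTerm CNotGen 2 2 := gen CNotGen.cnot

/-- The controlled-not gate in an extended signature. -/
def cnotExt : PropTerm (SMTheory.sumGen CNotGen G) 2 2 := gen (Sum.inl CNotGen.cnot)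

def unit : PropTerm (SMTheory.sumGen CNotGen UnitGen) 0 1 := gen (Sum.inr UnitGen.unit)

def not : PropTerm (SMTheory.sumGen CNotGen NotGen) 1 1 := gen (Sum.inr NotGen.not)

/-- The unit to the left of a wire. -/
def unitLeft : PropTerm (SMTheory.sumGen CNotGen UnitGen) 1 2 := tensor unit (PropTerm.id 1)

/-- A not gate on the left of two wires. -/
def notLeft : PropTerm (SMTheory.sumGen CNotGen NotGen) 2 2 := tensor not (PropTerm.id 1)

/-- A not gate on the right of two wires. -/
def notRight : PropTerm (SMTheory.sumGen CNotGen NotGen) 2 2 := tensor (PropTerm.id 1) not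

/-- A not gate on each of two wires. -/
def notBoth : PropTerm (SMTheory.sumGen CNotGen NotGen) 2 2 := tensor not not

end Circuit

open PropTerm Circuit in
/-- The relations between controlled-not gates. -/
inductive IsoCbEqn : ∀ {a b : ℕ}, PropTerm CNotGen a b → PropTerm CNotGen a b → Prop
  | one : IsoCbEqn (comp cnot cnot) (id 2)
  | two : IsoCbEqn (comp (flip cnot) (comp cnot (flip cnot))) swap
  | three : IsoCbEqn (comp (on23 cnot) (comp (on12 cnot) (on23 cnot)))
      (comp (on12 cnot) (on13 cnot))
  | four : IsoCbEqn (comp (on12 cnot) (on23 (flip cnot))) (comp (on23 (flip cnot)) (on12 cnot))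
  | five : IsoCbEqn (comp (on12 (flip cnot)) (on23 cnot)) (comp (on23 cnot) (on12 (flip cnot)))

/-- The theory of `Iso(cb₂)`. -/
def isoCbTheory : SMTheory where
  Gen := CNotGen
  Eqn := IsoCbEqn

open PropTerm Circuit in
/-- A controlled-not gate whose control is the unit acts as the identity on its target. -/
inductive MonoCbEqn : ∀ {a b : ℕ}, PropTerm (SMTheory.sumGen CNotGen UnitGen) a b →
    PropTerm (SMTheory.sumGen CNotGen UnitGen) a b → Prop
  | six : MonoCbEqn (comp unitLeft cnotExt) unitLeft

/-- The theory of `Mono(cb₂)`: the unit, subject to no equation of its own, is adjoined to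
`Iso(cb₂)`, and the equation above is imposed. -/
def monoCbTheory : SMTheory := isoCbTheory.extend UnitGen MonoCbEqn

open Circuit in
/-- The relations for not gates. -/
inductive IsoAffCbEqn : ∀ {a b : ℕ}, PropTerm (SMTheory.sumGen CNotGen NotGen) a b →
    PropTerm (SMTheory.sumGen CNotGen NotGen) a b → Prop
  | seven : IsoAffCbEqn (.comp not not) (.id 1)
  | eight : IsoAffCbEqn (.comp notLeft cnotExt) (.comp cnotExt notBoth)
  | nine : IsoAffCbEqn (.comp notRight cnotExt) (.comp cnotExt notRight)

/-- The theory of `Iso(Affcb₂)`: the not gate is adjoined to `Iso(cb₂)`. -/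
def isoAffCbTheory : SMTheory := isoCbTheory.extend NotGen IsoAffCbEqn

def IsoCb₂ : PROP := isoCbTheory.prop

def MonoCb₂ : PROP := monoCbTheory.prop

def IsoAffCb₂ : PROP := isoAffCbTheory.prop

/-- The canonical morphism `Iso(cb₂) → Mono(cb₂)`. -/
def isoCbToMonoCb : IsoCb₂ ⟶ MonoCb₂ := isoCbTheory.toExtend UnitGen MonoCbEqn

/-- The canonical morphism `Iso(cb₂) → Iso(Affcb₂)`. -/
def isoCbToIsoAffCb : IsoCb₂ ⟶ IsoAffCb₂ := isoCbTheory.toExtend NotGen IsoAffCbEqn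

/-- `Mono(Affcb₂)`: the pushout of `Mono(cb₂) ← Iso(cb₂) → Iso(Affcb₂)` in the category of
props. -/
noncomputable def MonoAffCb₂ : PROP := Limits.pushout isoCbToMonoCb isoCbToIsoAffCb

/-- The first coprojection `Mono(cb₂) → Mono(Affcb₂)` of the pushout. -/
noncomputable def monoCbToMonoAffCb : MonoCb₂ ⟶ MonoAffCb₂ :=
  Limits.pushout.inl isoCbToMonoCb isoCbToIsoAffCb

/-- The second coprojection `Iso(Affcb₂) → Mono(Affcb₂)` of the pushout. -/
noncomputable def isoAffCbToMonoAffCb : IsoAffCb₂ ⟶ MonoAffCb₂ :=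
  Limits.pushout.inr isoCbToMonoCb isoCbToIsoAffCb

/-! ### The interpretation of the generators -/

def cnotVal : ∀ {a b : ℕ}, CNotGen a b → MonoAffMat.Hom a b
  | _, _, CNotGen.cnot => ⟨AffMat.cnot, AffMat.isMono_cnot⟩

def unitVal : ∀ {a b : ℕ}, UnitGen a b → MonoAffMat.Hom a b
  | _, _, UnitGen.unit => ⟨AffMat.zero, AffMat.isMono_zero⟩

def notVal : ∀ {a b : ℕ}, NotGen a b → MonoAffMat.Hom a b
  | _, _, NotGen.not => ⟨AffMat.not, AffMat.isMono_not⟩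

theorem isoCb_sound {a b : ℕ} {s t : PropTerm CNotGen a b} (h : IsoCbEqn s t) :
    s.eval MonoAffMat cnotVal = t.eval MonoAffMat cnotVal := by
  cases h <;> exact Subtype.ext (by
    refine AffMat.ext ?_ ?_
    · decide +revert
    · decide +revert)

/-- The interpretation `Mono(cb₂) → Mono(AffMat(𝔽₂))`, which sends the controlled-not gate to
`(x, y) ↦ (x, x + y)` and the unit to `0`. -/
def monoCbInterp : MonoCb₂ ⟶ MonoAffMat :=
  isoCbTheory.extendLift UnitGen MonoCbEqn MonoAffMat cnotVal unitVal isoCb_sound (by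
    intro a b s t h
    cases h
    exact Subtype.ext (AffMat.ext (by decide) (by decide)))

/-- The interpretation `Iso(Affcb₂) → Mono(AffMat(𝔽₂))`, which sends the controlled-not gate to
`(x, y) ↦ (x, x + y)` and the not gate to `x ↦ x + 1`. -/
def isoAffCbInterp : IsoAffCb₂ ⟶ MonoAffMat :=
  isoCbTheory.extendLift NotGen IsoAffCbEqn MonoAffMat cnotVal notVal isoCb_sound (by
    intro a b s t h
    cases h <;> exact Subtype.ext (AffMat.ext (by decide) (by decide)))

-- Every map of the pushout is a word in symmetries, controlled-nots, nots and units, each padded by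
-- identity wires. The relations move the units to the front and the nots to the back, so that a
-- word equals `f ⨾ (g * N)`: `f` is a block of units to the left of an identity, `g` is a word of
-- controlled-nots and symmetries, `N` is a tensor product of nots and identities
-- (`Word.exists_normal`). Such a word acts by `v ↦ g (f v) + t`. Products in endomorphism monoids
-- are in diagrammatic order.
--
-- Faithfulness (`word_ext`). The map `f` depends only on its source and target, and `N` is
-- determined by the image of `0`. What remains is that a `g` fixing the image of `f` pointwise
-- satisfies `f ⨾ g = f` (`incl_comp_lin`). If `f` consists of units only, they absorb every linear
-- gate. Otherwise write `g = R * lift g' * A` (`Lin.exists_coset`): `R` adds a linear form in the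
-- other wires to the last wire, so that `R * lift g'` fixes the last basis vector `e`, and `A`
-- belongs to a list of coset representatives, one for each possible image of `e`. As `e` lies in
-- the image of `f`, `A = 1`. Moved through `f` (`Incl.pushes`), `R` becomes a row that acts
-- trivially, hence is trivial, and `g'` is handled by induction. With `f` an identity this shows
-- that the relations of `Iso(cb₂)` present the groups `GL_n(𝔽₂)`. The decomposition rests on a
-- finite table of three-wire identities, which tells how a representative is multiplied by a gate
-- (`Coset.mul_lin`).
--
-- Fullness (`exists_word`). Gaussian elimination produces the same factors `R`, `lift w`, `A` from
-- an injective linear map, and nots supply the translation.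

local infixr:80 " ⨾ " => PROP.comp _

/-! ### Layers of a prop -/

namespace PROP

/-- A map with one more wire on the right. -/
def lift (P : PROP) {a b : ℕ} (f : P.Hom a b) : P.Hom (a + 1) (b + 1) := P.tensor f (P.id 1)

/-- A map with `m` more wires on the left. -/
def whisk (P : PROP) (m : ℕ) {a b : ℕ} (f : P.Hom a b) : P.Hom (m + a) (m + b) :=
  P.tensor (P.id m) f

/-- The symmetry of two single wires. -/
def swap (P : PROP) : P.Hom 2 2 := P.symm 1 1

variable {P : PROP}

theorem lift_id (a : ℕ) : P.lift (P.id a) = P.id (a + 1) := P.tensor_id a 1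

theorem lift_comp {a b c : ℕ} (f : P.Hom a b) (g : P.Hom b c) :
    P.lift (f ⨾ g) = P.lift f ⨾ P.lift g := by
  unfold lift
  rw [← P.tensor_comp, P.comp_id]

theorem whisk_id (m a : ℕ) : P.whisk m (P.id a) = P.id (m + a) := P.tensor_id m a

theorem whisk_comp (m : ℕ) {a b c : ℕ} (f : P.Hom a b) (g : P.Hom b c) :
    P.whisk m (f ⨾ g) = P.whisk m f ⨾ P.whisk m g := by
  unfold whisk
  rw [← P.tensor_comp, P.comp_id]

theorem lift_whisk (m : ℕ) {a b : ℕ} (f : P.Hom a b) :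
    P.lift (P.whisk m f) = P.whisk m (P.lift f) :=
  P.tensor_assoc (P.id m) f (P.id 1)

theorem lift_lift {a b : ℕ} (f : P.Hom a b) : P.lift (P.lift f) = P.tensor f (P.id 2) :=
  (P.tensor_assoc f (P.id 1) (P.id 1)).trans (congrArg (P.tensor f) (P.tensor_id 1 1))

/-- The arities of `g` are numerals here and in the two variants below, so that both sides have
definitionally equal types and `tensor_assoc` needs no transport. -/
theorem whisk_add_two (k m : ℕ) (g : P.Hom 2 2) :
    P.whisk (k + m) g = P.whisk k (P.whisk m g) :=
  (congrArg (fun t => P.tensor t g) (P.tensor_id k m)).symm.trans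
    (P.tensor_assoc (P.id k) (P.id m) g)

theorem whisk_add_one (k m : ℕ) (g : P.Hom 1 1) :
    P.whisk (k + m) g = P.whisk k (P.whisk m g) :=
  (congrArg (fun t => P.tensor t g) (P.tensor_id k m)).symm.trans
    (P.tensor_assoc (P.id k) (P.id m) g)

theorem whisk_add_unit (k m : ℕ) (g : P.Hom 0 1) :
    P.whisk (k + m) g = P.whisk k (P.whisk m g) :=
  (congrArg (fun t => P.tensor t g) (P.tensor_id k m)).symm.trans
    (P.tensor_assoc (P.id k) (P.id m) g)

theorem tensor_eq_left {a b c d : ℕ} (f : P.Hom a b) (g : P.Hom c d) :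
    P.tensor f g = P.tensor f (P.id c) ⨾ P.tensor (P.id b) g := by
  rw [← P.tensor_comp, P.comp_id, P.id_comp]

theorem tensor_eq_right {a b c d : ℕ} (f : P.Hom a b) (g : P.Hom c d) :
    P.tensor f g = P.tensor (P.id a) g ⨾ P.tensor f (P.id d) := by
  rw [← P.tensor_comp, P.comp_id, P.id_comp]

theorem lift_lift_comp_whisk {a b : ℕ} (f : P.Hom a b) (g : P.Hom 2 2) :
    P.lift (P.lift f) ⨾ P.whisk b g = P.whisk a g ⨾ P.lift (P.lift f) := by
  rw [lift_lift]
  exact (tensor_eq_left f g).symm.trans (tensor_eq_right f g)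

theorem lift_comp_whisk {a b : ℕ} (f : P.Hom a b) (g : P.Hom 1 1) :
    P.lift f ⨾ P.whisk b g = P.whisk a g ⨾ P.lift f :=
  (tensor_eq_left f g).symm.trans (tensor_eq_right f g)

/-- Interchange again, with `f` read as `tensor f (id 0)`. -/
theorem comp_whisk_unit {a b : ℕ} (f : P.Hom a b) (g : P.Hom 0 1) :
    f ⨾ P.whisk b g = P.whisk a g ⨾ P.lift f :=
  (congrArg (fun t => P.comp t (P.whisk b g)) (P.tensor_unit f)).symm.trans
    ((tensor_eq_left f g).symm.trans (tensor_eq_right f g))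

theorem swap_swap : P.swap ⨾ P.swap = P.id 2 := P.symm_symm 1 1

theorem symm_one_two : P.symm 1 2 = P.lift P.swap ⨾ P.whisk 1 P.swap := P.hexagon 1 1 1

/-- Naturality of `symm 1 2`, which is a composite of two adjacent swaps. It yields the braid
relation for `g = swap` and the sliding of a controlled-not along two swaps for `g = c`. -/
theorem whisk_comp_lift_swap (g : P.Hom 2 2) :
    P.whisk 1 g ⨾ P.lift P.swap ⨾ P.whisk 1 P.swap =
      P.lift P.swap ⨾ P.whisk 1 P.swap ⨾ P.lift g := by
  have h := P.symm_natural (P.id 1) g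
  rw [symm_one_two] at h
  exact h.trans (P.assoc _ _ _)

end PROP

/-! ### Identities between gates on three wires -/

/-- Elements of a monoid that behave as the symmetry, the controlled-not gate and the flipped
controlled-not gate on two wires. -/
structure CnotPair {M : Type*} [Monoid M] (s c d : M) : Prop where
  ss : s * s = 1
  cc : c * c = 1
  flip : d = s * (c * s)
  dcd : d * (c * d) = s

namespace CnotPair

variable {M : Type*} [Monoid M] {s c d : M}

theorem s_s (h : CnotPair s c d) (x : M) : s * (s * x) = x := by rw [← mul_assoc, h.ss, one_mul]

theorem c_c (h : CnotPair s c d) (x : M) : c * (c * x) = x := by rw [← mul_assoc, h.cc, one_mul]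

theorem dd (h : CnotPair s c d) : d * d = 1 := by
  rw [h.flip]; simp only [mul_assoc, h.s_s, h.c_c, h.ss]

theorem d_d (h : CnotPair s c d) (x : M) : d * (d * x) = x := by rw [← mul_assoc, h.dd, one_mul]

/-- `s`, `c`, `d` multiply like the three transpositions in `GL₂(𝔽₂) ≅ S₃`. Each 3-cycle has three
expressions, `s * c = c * d = d * s` and `d * c = c * s = s * d`; this lemma and the next ones
convert between them. -/
theorem ds (h : CnotPair s c d) : d * s = s * c := by
  rw [h.flip]; simp only [mul_assoc, h.ss, mul_one]

theorem sd (h : CnotPair s c d) : s * d = c * s := by rw [h.flip, h.s_s]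

theorem sc (h : CnotPair s c d) : s * c = c * d := by rw [← h.ds, ← h.dcd, h.d_d]

theorem dc (h : CnotPair s c d) : d * c = c * s := by
  have h₁ := congrArg (· * d) h.dcd
  simp only [mul_assoc, h.dd, mul_one] at h₁
  rw [h₁, h.sd]

end CnotPair

/-- Elements of a monoid that behave as the two-wire gates on the last two (index `0`) and on the
first two (index `1`) of three wires. -/
structure CnotTriple {M : Type*} [Monoid M] (s₀ s₁ c₀ c₁ d₀ d₁ : M) : Prop where
  pair₀ : CnotPair s₀ c₀ d₀
  pair₁ : CnotPair s₁ c₁ d₁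
  braid : s₀ * (s₁ * s₀) = s₁ * (s₀ * s₁)
  slide : c₀ * (s₁ * s₀) = s₁ * (s₀ * c₁)
  three : c₀ * (c₁ * c₀) = c₁ * (s₀ * (c₁ * s₀))
  four : c₁ * d₀ = d₀ * c₁
  five : d₁ * c₀ = c₀ * d₁

theorem mul_left_of_eq {M : Type*} [Monoid M] {a b c d : M} (h : a * b = c * d) (x : M) :
    a * (b * x) = c * (d * x) := by rw [← mul_assoc, h, mul_assoc]

namespace CnotTriple

variable {M : Type*} [Monoid M] {s₀ s₁ c₀ c₁ d₀ d₁ : M}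

/-- Here and below, `s₀ * (c₁ * s₀)` is the gate from the first wire to the third; conjugation by
`s₁` turns it into `c₀`. -/
theorem s₁_s₀_c₁ (h : CnotTriple s₀ s₁ c₀ c₁ d₀ d₁) : s₁ * (s₀ * (c₁ * s₀)) = c₀ * s₁ := by
  have := congrArg (· * s₀) h.slide
  simp only [mul_assoc, h.pair₀.ss, mul_one] at this
  exact this.symm

theorem s₁_c₀ (h : CnotTriple s₀ s₁ c₀ c₁ d₀ d₁) : s₁ * c₀ = s₀ * (c₁ * (s₀ * s₁)) := by
  have := congrArg (s₁ * · * s₁) h.s₁_s₀_c₁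
  simp only [mul_assoc, h.pair₁.ss, h.pair₁.s_s, mul_one] at this
  exact this.symm

theorem s₀_s₁_c₀ (h : CnotTriple s₀ s₁ c₀ c₁ d₀ d₁) : s₀ * (s₁ * c₀) = c₁ * (s₀ * s₁) := by
  rw [h.s₁_c₀, h.pair₀.s_s]

/-- Both sides are the gate with control on the third wire and target on the first. Expressed
through `c₁`, they differ by braid moves. -/
theorem s₀_d₁_s₀ (h : CnotTriple s₀ s₁ c₀ c₁ d₀ d₁) : s₀ * (d₁ * s₀) = s₁ * (d₀ * s₁) := by
  have e : c₀ = s₁ * (s₀ * (c₁ * (s₀ * s₁))) := by rw [← h.s₁_c₀, h.pair₁.s_s]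
  have b : s₁ * (s₀ * (s₁ * s₀)) = s₀ * s₁ := by
    rw [h.braid, h.pair₁.s_s]
  have b' : s₀ * (s₁ * (s₀ * s₁)) = s₁ * s₀ := by
    rw [← h.braid, h.pair₀.s_s]
  rw [h.pair₁.flip, h.pair₀.flip, e]
  simp only [mul_assoc]
  rw [b', ← mul_assoc s₁ s₀, ← mul_assoc (s₁ * s₀) s₁, ← mul_assoc (s₁ * s₀ * s₁) s₀]
  rw [mul_assoc s₁ s₀ s₁, mul_assoc s₁, mul_assoc s₀ s₁ s₀, b]
  simp only [mul_assoc]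

theorem d₀_s₁_s₀ (h : CnotTriple s₀ s₁ c₀ c₁ d₀ d₁) : d₀ * (s₁ * s₀) = s₁ * (s₀ * d₁) := by
  have := congrArg (s₁ * · * s₀) h.s₀_d₁_s₀
  simp only [mul_assoc, h.pair₁.s_s, h.pair₀.ss, mul_one] at this
  exact this.symm

/-- Gates with a common control commute. -/
theorem c₁_comm (h : CnotTriple s₀ s₁ c₀ c₁ d₀ d₁) :
    c₁ * (s₀ * (c₁ * s₀)) = s₀ * (c₁ * (s₀ * c₁)) := by
  have e : s₀ * (c₁ * s₀) = s₁ * (c₀ * s₁) := by rw [← h.s₁_s₀_c₁, h.pair₁.s_s]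
  have := congrArg (s₁ * · * s₁) h.five
  have e' : s₀ * (c₁ * (s₀ * c₁)) = s₁ * (c₀ * s₁) * c₁ := by rw [← e]; simp only [mul_assoc]
  rw [h.pair₁.flip] at this
  simp only [mul_assoc, h.pair₁.s_s, h.pair₁.ss, mul_one] at this
  rw [e, e', this]; simp only [mul_assoc]

/-- Gates with a common target commute. -/
theorem c₀_comm (h : CnotTriple s₀ s₁ c₀ c₁ d₀ d₁) :
    s₀ * (c₁ * (s₀ * c₀)) = c₀ * (s₀ * (c₁ * s₀)) := by
  have := congrArg (s₀ * · * s₀) h.four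
  rw [h.pair₀.flip] at this
  simp only [mul_assoc, h.pair₀.s_s, h.pair₀.ss, mul_one] at this
  exact this

/-- The commutator relation of elementary matrices: exchanging first-to-second with second-to-third
costs a gate from first to third. -/
theorem c₁_c₀ (h : CnotTriple s₀ s₁ c₀ c₁ d₀ d₁) :
    c₁ * c₀ = c₀ * (s₀ * (c₁ * (s₀ * c₁))) := by
  rw [← h.c₁_comm, ← h.three, h.pair₀.c_c]

/-- For `a` among `s₀`, `d₀`, `b` among `s₁`, `d₁` and `g` among `s₀`, `c₀`, the product `a * b * g`
equals `h * a' * b'` with `h` fixing the last basis vector and `a'`, `b'` of the same kinds. The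
eight entries are `braid`, `s₀_d₁_s₀`, `d₀_s₁_s₀`, `d₀_d₁_s₀`, `s₀_s₁_c₀`, `s₀_d₁_c₀`, `d₀_s₁_c₀`
and `d₀_d₁_c₀`. -/
theorem d₀_s₁_c₀ (h : CnotTriple s₀ s₁ c₀ c₁ d₀ d₁) :
    d₀ * (s₁ * c₀) = s₀ * (c₁ * (s₀ * (c₁ * (d₀ * s₁)))) := by
  have e : s₁ * c₀ = s₀ * (c₁ * (s₀ * s₁)) := h.s₁_c₀
  have t := congrArg (s₀ * · * s₀) h.three
  simp only [mul_assoc, h.pair₀.ss, mul_one] at t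
  rw [e, h.pair₀.flip]
  simp only [mul_assoc, h.pair₀.s_s]
  -- Inserting `c₀ * c₀` and `s₀ * s₀` makes the left side of `three` appear.
  have t' : s₀ * (c₀ * (c₁ * (s₀ * s₁))) = s₀ * (c₀ * (c₁ * (c₀ * s₀))) * (s₀ * (c₀ * (s₀ * s₁))) := by
    simp only [mul_assoc, h.pair₀.s_s, h.pair₀.c_c]
  rw [t', t]
  simp only [mul_assoc]

theorem s₀_d₁_c₀ (h : CnotTriple s₀ s₁ c₀ c₁ d₀ d₁) : s₀ * (d₁ * c₀) = c₀ * (d₀ * d₁) := by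
  rw [h.five, ← mul_assoc, h.pair₀.sc, mul_assoc]

theorem d₀_d₁_c₀ (h : CnotTriple s₀ s₁ c₀ c₁ d₀ d₁) : d₀ * (d₁ * c₀) = c₀ * (s₀ * d₁) := by
  rw [h.five, ← mul_assoc, h.pair₀.dc, mul_assoc]

theorem d₀_d₁_s₀ (h : CnotTriple s₀ s₁ c₀ c₁ d₀ d₁) :
    d₀ * (d₁ * s₀) = c₀ * (d₁ * (d₀ * d₁)) := by
  have r : c₁ * (s₀ * s₁) = s₀ * s₁ * c₀ := by rw [← h.s₀_s₁_c₀, mul_assoc]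
  have q : c₀ * (s₀ * s₁) = s₀ * s₁ * (s₀ * (d₁ * s₀)) := by
    rw [h.s₀_d₁_s₀, mul_assoc, h.pair₁.s_s, ← mul_assoc, ← h.pair₀.sd, mul_assoc]
  have p : c₁ * s₁ = s₁ * d₁ := h.pair₁.sd.symm
  -- The relation `three` is conjugated by the 3-cycle of wires `s₀ * s₁`; `r`, `q` and `p` move
  -- this permutation to the left past the gates, where it cancels.
  have t : c₀ * (c₁ * (c₀ * (s₀ * s₁))) = c₁ * (s₀ * (c₁ * (s₀ * (s₀ * s₁)))) := by
    simpa only [mul_assoc] using congrArg (· * (s₀ * s₁)) h.three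
  rw [q, mul_left_of_eq r, mul_left_of_eq q, h.pair₀.s_s, p, ← mul_assoc s₀ s₁,
    mul_left_of_eq r] at t
  have t' := congrArg (fun x => s₁ * (s₀ * x)) t
  simp only [mul_assoc, h.pair₀.s_s, h.pair₁.s_s] at t'
  have t'' := congrArg (fun x => d₁ * (s₀ * x)) t'
  simp only [h.pair₀.s_s, h.pair₁.d_d] at t''
  rw [mul_left_of_eq h.five.symm, ← mul_assoc c₀ d₀, ← h.pair₀.sc, mul_assoc, ← h.five,
    h.five, ← t'', h.pair₀.flip]
  simp only [mul_assoc]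

end CnotTriple

/-! ### Gates in a prop -/

/-- A controlled-not gate, a unit and a not gate in a prop, subject to the relations of
`Mono(cb₂)` and `Iso(Affcb₂)`. -/
structure PROP.Gates (P : PROP) where
  c : P.Hom 2 2
  u : P.Hom 0 1
  n : P.Hom 1 1
  c_c : c ⨾ c = P.id 2
  dcd : (P.swap ⨾ c ⨾ P.swap) ⨾ c ⨾ (P.swap ⨾ c ⨾ P.swap) = P.swap
  three : P.whisk 1 c ⨾ P.lift c ⨾ P.whisk 1 c =
    P.lift c ⨾ P.whisk 1 P.swap ⨾ P.lift c ⨾ P.whisk 1 P.swap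
  four : P.lift c ⨾ P.whisk 1 (P.swap ⨾ c ⨾ P.swap) = P.whisk 1 (P.swap ⨾ c ⨾ P.swap) ⨾ P.lift c
  five : P.lift (P.swap ⨾ c ⨾ P.swap) ⨾ P.whisk 1 c = P.whisk 1 c ⨾ P.lift (P.swap ⨾ c ⨾ P.swap)
  u_c : P.lift u ⨾ c = P.lift u
  n_n : n ⨾ n = P.id 1
  n_c : P.lift n ⨾ c = c ⨾ P.tensor n n
  c_n : P.whisk 1 n ⨾ c = c ⨾ P.whisk 1 n

namespace PROP

/-- The monoid of endomorphisms of an object of a prop. -/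
instance endMonoid (P : PROP) (m : ℕ) : Monoid (P.Hom m m) where
  mul f g := P.comp f g
  mul_assoc := P.assoc
  one := P.id m
  one_mul := P.id_comp
  mul_one := P.comp_id

variable {P : PROP}

/-- The hexagon with two empty factors makes `symm 1 0` idempotent, and it is invertible. -/
theorem symm_one_zero : P.symm 1 0 = P.id 1 := by
  have h₁ : P.symm 1 0 = P.symm 1 0 ⨾ P.symm 1 0 := by
    refine (P.hexagon 1 0 0).trans ?_
    exact congrArg₂ (fun x y => P.comp x y) (P.tensor_unit (P.symm 1 0))
      (P.unit_tensor (P.symm 1 0))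
  have h₂ := congrArg (fun t => P.comp t (P.symm 0 1)) h₁
  have h₃ : P.symm 1 0 ⨾ P.symm 0 1 = P.id 1 := P.symm_symm 1 0
  rw [P.assoc, h₃] at h₂
  exact (P.comp_id _).symm.trans h₂.symm

namespace Gates

variable (G : P.Gates)

/-- The symmetry on the last two wires. -/
def sw (_ : P.Gates) (m : ℕ) : P.Hom (m + 1 + 1) (m + 1 + 1) := P.whisk m P.swap

/-- The controlled-not gate on the last two wires, with the control on the left. -/
def cn (m : ℕ) : P.Hom (m + 1 + 1) (m + 1 + 1) := P.whisk m G.c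

/-- The controlled-not gate on the last two wires, with the control on the right. -/
def dn (m : ℕ) : P.Hom (m + 1 + 1) (m + 1 + 1) := P.whisk m (P.swap ⨾ G.c ⨾ P.swap)

/-- The not gate on the last wire. -/
def nt (m : ℕ) : P.Hom (m + 1) (m + 1) := P.whisk m G.n

/-- The unit to the right of all wires. -/
def un (m : ℕ) : P.Hom m (m + 1) := P.whisk m G.u

theorem dn_eq (m : ℕ) : G.dn m = G.sw m ⨾ G.cn m ⨾ G.sw m := by
  unfold dn sw cn
  rw [whisk_comp, whisk_comp]

theorem cnotPair (m : ℕ) :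
    CnotPair (G.sw m) (G.cn m) (G.dn m) := by
  refine ⟨?_, ?_, G.dn_eq m, ?_⟩
  · exact (whisk_comp m P.swap P.swap).symm.trans
      ((congrArg (P.whisk m) swap_swap).trans (whisk_id m 2))
  · exact (whisk_comp m G.c G.c).symm.trans ((congrArg (P.whisk m) G.c_c).trans (whisk_id m 2))
  · have := congrArg (P.whisk m) G.dcd
    rw [whisk_comp, whisk_comp m G.c] at this
    exact this

theorem cnotTriple (m : ℕ) :
    CnotTriple (G.sw (m + 1)) (P.lift (G.sw m)) (G.cn (m + 1))
      (P.lift (G.cn m)) (G.dn (m + 1)) (P.lift (G.dn m)) := by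
  have l : ∀ g : P.Hom 2 2, P.lift (P.whisk m g) = P.whisk m (P.lift g) := fun g => lift_whisk m g
  have w : ∀ g : P.Hom 2 2, P.whisk (m + 1) g = P.whisk m (P.whisk 1 g) :=
    fun g => whisk_add_two m 1 g
  have k : ∀ f g : P.Hom 3 3, P.whisk m (f ⨾ g) = P.whisk m f ⨾ P.whisk m g :=
    fun f g => whisk_comp m f g
  have lc := fun f g : P.Hom (m + 1 + 1) (m + 1 + 1) => lift_comp f g
  have p := G.cnotPair m
  refine ⟨G.cnotPair (m + 1), ⟨?_, ?_, ?_, ?_⟩, ?_, ?_, ?_, ?_, ?_⟩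
  · exact (lc _ _).symm.trans ((congrArg P.lift p.ss).trans (lift_id _))
  · exact (lc _ _).symm.trans ((congrArg P.lift p.cc).trans (lift_id _))
  · exact (congrArg P.lift p.flip).trans ((lc _ _).trans (congrArg _ (lc _ _)))
  · exact ((lc _ _).trans (congrArg _ (lc _ _))).symm.trans (congrArg P.lift p.dcd)
  · have := congrArg (P.whisk m) (whisk_comp_lift_swap P.swap)
    rw [k, k, k, k, ← l, ← w] at this
    exact this
  · have := congrArg (P.whisk m) (whisk_comp_lift_swap G.c)
    rw [k, k, k, k, ← l, ← l, ← w, ← w] at this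
    exact this
  · have := congrArg (P.whisk m) G.three
    rw [k, k, k, k, k, ← l, ← w, ← w] at this
    exact this
  · have := congrArg (P.whisk m) G.four
    rw [k, k, ← l, ← w] at this
    exact this
  · have := congrArg (P.whisk m) G.five
    rw [k, k, ← l, ← w] at this
    exact this

theorem lift_lift_sw {a b : ℕ} (f : P.Hom a b) :
    P.lift (P.lift f) ⨾ G.sw b = G.sw a ⨾ P.lift (P.lift f) := lift_lift_comp_whisk f _

theorem lift_lift_cn {a b : ℕ} (f : P.Hom a b) :
    P.lift (P.lift f) ⨾ G.cn b = G.cn a ⨾ P.lift (P.lift f) := lift_lift_comp_whisk f _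

theorem lift_lift_dn {a b : ℕ} (f : P.Hom a b) :
    P.lift (P.lift f) ⨾ G.dn b = G.dn a ⨾ P.lift (P.lift f) := lift_lift_comp_whisk f _

theorem lift_nt {a b : ℕ} (f : P.Hom a b) : P.lift f ⨾ G.nt b = G.nt a ⨾ P.lift f :=
  lift_comp_whisk f _

theorem comp_un {a b : ℕ} (f : P.Hom a b) : f ⨾ G.un b = G.un a ⨾ P.lift f :=
  comp_whisk_unit f _

/-- Naturality of the symmetry against the unit, where `symm 1 0` is the identity. -/
theorem lift_un_eq (m : ℕ) : P.lift (G.un m) = G.un (m + 1) ⨾ G.sw m := by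
  have e : P.lift G.u = P.whisk 1 G.u ⨾ P.swap := by
    have h := P.symm_natural (P.id 1) G.u
    rw [symm_one_zero] at h
    exact ((P.id_comp _).symm.trans h.symm)
  have h : P.whisk m (P.lift G.u) = P.whisk m (P.whisk 1 G.u) ⨾ P.whisk m P.swap :=
    (congrArg (P.whisk m) e).trans (whisk_comp m (P.whisk 1 G.u) P.swap)
  exact (lift_whisk m G.u).trans (h.trans
    (congrArg (fun t => P.comp t (P.whisk m P.swap)) (whisk_add_unit m 1 G.u)).symm)

theorem lift_un_cn (m : ℕ) : P.lift (G.un m) ⨾ G.cn m = P.lift (G.un m) := by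
  have h : P.whisk m (P.lift G.u) ⨾ P.whisk m G.c = P.whisk m (P.lift G.u) :=
    (whisk_comp m (P.lift G.u) G.c).symm.trans (congrArg (P.whisk m) G.u_c)
  have l : P.lift (G.un m) = P.whisk m (P.lift G.u) := lift_whisk m G.u
  rw [l]
  exact h

theorem nt_nt (m : ℕ) : G.nt m ⨾ G.nt m = P.id (m + 1) :=
  (whisk_comp m G.n G.n).symm.trans ((congrArg (P.whisk m) G.n_n).trans (whisk_id m 1))

theorem lift_nt_eq (m : ℕ) : P.lift (G.nt m) = P.whisk m (P.lift G.n) := lift_whisk m G.n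

theorem nt_succ (m : ℕ) : G.nt (m + 1) = P.whisk m (P.whisk 1 G.n) := whisk_add_one m 1 G.n

theorem lift_nt_cn (m : ℕ) :
    P.lift (G.nt m) ⨾ G.cn m = G.cn m ⨾ P.lift (G.nt m) ⨾ G.nt (m + 1) := by
  rw [lift_nt_eq, nt_succ]
  have e : P.tensor G.n G.n = P.lift G.n ⨾ P.whisk 1 G.n := tensor_eq_left G.n G.n
  have h := G.n_c
  rw [e] at h
  have h2 := congrArg (P.whisk m) h
  have k : ∀ f g : P.Hom 2 2, P.whisk m (f ⨾ g) = P.whisk m f ⨾ P.whisk m g :=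
    fun f g => whisk_comp m f g
  exact (k _ _).symm.trans (h2.trans ((k _ _).trans (congrArg _ (k _ _))))

theorem nt_cn (m : ℕ) : G.nt (m + 1) ⨾ G.cn m = G.cn m ⨾ G.nt (m + 1) := by
  rw [nt_succ]
  have k : ∀ f g : P.Hom 2 2, P.whisk m (f ⨾ g) = P.whisk m f ⨾ P.whisk m g :=
    fun f g => whisk_comp m f g
  exact (k _ _).symm.trans ((congrArg (P.whisk m) G.c_n).trans (k _ _))

theorem lift_nt_sw (m : ℕ) : P.lift (G.nt m) ⨾ G.sw m = G.sw m ⨾ G.nt (m + 1) := by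
  rw [lift_nt_eq, nt_succ]
  have k : ∀ f g : P.Hom 2 2, P.whisk m (f ⨾ g) = P.whisk m f ⨾ P.whisk m g :=
    fun f g => whisk_comp m f g
  exact (k _ _).symm.trans
    ((congrArg (P.whisk m) (P.symm_natural G.n (P.id 1))).trans (k _ _))

theorem nt_sw (m : ℕ) : G.nt (m + 1) ⨾ G.sw m = G.sw m ⨾ P.lift (G.nt m) := by
  rw [lift_nt_eq, nt_succ]
  have k : ∀ f g : P.Hom 2 2, P.whisk m (f ⨾ g) = P.whisk m f ⨾ P.whisk m g :=
    fun f g => whisk_comp m f g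
  exact (k _ _).symm.trans
    ((congrArg (P.whisk m) (P.symm_natural (P.id 1) G.n)).trans (k _ _))

end Gates

end PROP

/-! ### Words of gates -/

namespace PROP

variable {P : PROP}

theorem lift_mul {m : ℕ} (f g : P.Hom m m) : P.lift (f * g) = P.lift f * P.lift g := lift_comp f g

theorem lift_one (m : ℕ) : P.lift (1 : P.Hom m m) = 1 := lift_id m

theorem comp_mul {a b : ℕ} (f : P.Hom a b) (g h : P.Hom b b) : f ⨾ (g * h) = (f ⨾ g) ⨾ h :=
  (P.assoc f g h).symm

theorem mul_comp {a b : ℕ} (g h : P.Hom a a) (f : P.Hom a b) : (g * h) ⨾ f = g ⨾ (h ⨾ f) :=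
  P.assoc g h f

namespace Gates

variable (G : P.Gates)

/-- Words of controlled-not gates and symmetries. -/
inductive Lin : ∀ m : ℕ, P.Hom m m → Prop
  | one (m : ℕ) : Lin m 1
  | mul {m : ℕ} {f g : P.Hom m m} : Lin m f → Lin m g → Lin m (f * g)
  | sw (m : ℕ) : Lin (m + 1 + 1) (G.sw m)
  | cn (m : ℕ) : Lin (m + 1 + 1) (G.cn m)
  | lift {m : ℕ} {f : P.Hom m m} : Lin m f → Lin (m + 1) (P.lift f)

/-- Normal forms of composites of controlled-not gates whose target is the last wire. -/
inductive Row : ∀ m : ℕ, P.Hom (m + 1) (m + 1) → Prop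
  | one : Row 0 1
  | skip {m : ℕ} {R : P.Hom (m + 1) (m + 1)} : Row m R →
      Row (m + 1) (G.sw m * (P.lift R * G.sw m))
  | add {m : ℕ} {R : P.Hom (m + 1) (m + 1)} : Row m R →
      Row (m + 1) (G.sw m * (P.lift R * G.sw m) * G.cn m)

/-- Representatives of the cosets of the stabilizer of the last basis vector. -/
inductive Coset : ∀ m : ℕ, P.Hom (m + 1) (m + 1) → Prop
  | one (m : ℕ) : Coset m 1
  | sw {m : ℕ} {A : P.Hom (m + 1) (m + 1)} : Coset m A → Coset (m + 1) (G.sw m * P.lift A)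
  | dn {m : ℕ} {A : P.Hom (m + 1) (m + 1)} : Coset m A → Coset (m + 1) (G.dn m * P.lift A)

/-- Tensor products of units with an identity. -/
inductive Incl : ∀ a b : ℕ, P.Hom a b → Prop
  | one : Incl 0 0 (P.id 0)
  | un {m : ℕ} {f : P.Hom 0 m} : Incl 0 m f → Incl 0 (m + 1) (f ⨾ G.un m)
  | lift {a b : ℕ} {f : P.Hom a b} : Incl a b f → Incl (a + 1) (b + 1) (P.lift f)

/-- Tensor products of identities of single wires and of not gates. -/
inductive Nots : ∀ m : ℕ, P.Hom m m → Prop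
  | one : Nots 0 1
  | skip {m : ℕ} {N : P.Hom m m} : Nots m N → Nots (m + 1) (P.lift N)
  | nt {m : ℕ} {N : P.Hom m m} : Nots m N → Nots (m + 1) (P.lift N * G.nt m)

variable {G}

theorem Lin.dn (m : ℕ) : G.Lin (m + 1 + 1) (G.dn m) := by
  rw [dn_eq]
  exact (Lin.sw m).mul ((Lin.cn m).mul (Lin.sw m))

theorem Lin.zero {f : P.Hom 0 0} (h : G.Lin 0 f) : f = 1 := by
  have key : ∀ (m : ℕ) (f : P.Hom m m), G.Lin m f → ∀ e : m = 0, f = 1 := by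
    intro m f h
    induction h with
    | one m => exact fun _ => rfl
    | mul _ _ ih ih' => intro e; rw [ih e, ih' e, one_mul]
    | sw m => intro e; omega
    | cn m => intro e; omega
    | lift _ _ => intro e; omega
  exact key 0 f h rfl

theorem Lin.exists_inv {m : ℕ} {f : P.Hom m m} (h : G.Lin m f) :
    ∃ g, G.Lin m g ∧ f * g = 1 ∧ g * f = 1 := by
  induction h with
  | one m => exact ⟨1, Lin.one m, one_mul _, one_mul _⟩
  | mul _ _ ih ih' =>
    obtain ⟨g, hg, h₁, h₂⟩ := ih
    obtain ⟨g', hg', h₁', h₂'⟩ := ih'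
    refine ⟨g' * g, hg'.mul hg, ?_, ?_⟩
    · rw [mul_assoc, ← mul_assoc _ g', h₁', one_mul, h₁]
    · rw [mul_assoc, ← mul_assoc g, h₂, one_mul, h₂']
  | sw m => exact ⟨_, Lin.sw m, (G.cnotPair m).ss, (G.cnotPair m).ss⟩
  | cn m => exact ⟨_, Lin.cn m, (G.cnotPair m).cc, (G.cnotPair m).cc⟩
  | lift _ ih =>
    obtain ⟨g, hg, h₁, h₂⟩ := ih
    exact ⟨_, hg.lift, by rw [← lift_mul, h₁, lift_one], by rw [← lift_mul, h₂, lift_one]⟩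

theorem Row.lin {m : ℕ} {R : P.Hom (m + 1) (m + 1)} (h : G.Row m R) : G.Lin (m + 1) R := by
  induction h with
  | one => exact Lin.one _
  | skip _ ih => exact (Lin.sw _).mul (ih.lift.mul (Lin.sw _))
  | add _ ih => exact ((Lin.sw _).mul (ih.lift.mul (Lin.sw _))).mul (Lin.cn _)

theorem Coset.lin {m : ℕ} {A : P.Hom (m + 1) (m + 1)} (h : G.Coset m A) : G.Lin (m + 1) A := by
  induction h with
  | one => exact Lin.one _
  | sw _ ih => exact (Lin.sw _).mul ih.lift
  | dn _ ih => exact (Lin.dn _).mul ih.lift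

/-! ### Rows: the abelian group of gates with the last wire as target. -/

theorem Row.one' (m : ℕ) : G.Row m 1 := by
  induction m with
  | zero => exact Row.one
  | succ m ih =>
    have := Row.skip ih
    rwa [lift_one, one_mul, (G.cnotPair m).ss] at this

theorem Row.cn (m : ℕ) : G.Row (m + 1) (G.cn m) := by
  have := Row.add (Row.one' (G := G) m)
  rwa [lift_one, one_mul, (G.cnotPair m).ss, one_mul] at this

/-- A composite of gates with a common target commutes with a gate with the same target and with
its control to the right. -/
theorem Row.lift_commute_dn {m : ℕ} {R : P.Hom (m + 1) (m + 1)} (h : G.Row m R) :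
    Commute (P.lift R) (G.dn m) := by
  have skip : ∀ {m : ℕ} {R : P.Hom (m + 1) (m + 1)}, Commute (P.lift R) (G.dn m) →
      Commute (P.lift (G.sw m * (P.lift R * G.sw m))) (G.dn (m + 1)) := by
    intro m R ih
    have t := G.cnotTriple m
    have e₀ : Commute (P.lift (P.lift R)) (G.sw (m + 1)) := G.lift_lift_sw R
    have e₁ : Commute (P.lift (P.lift R)) (P.lift (G.dn m)) := by
      have := congrArg P.lift ih.eq
      rwa [lift_mul, lift_mul] at this
    -- By `s₀_d₁_s₀` this gate is also a conjugate of `lift (dn m)`, to which the induction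
    -- hypothesis applies, by a swap that does not meet `lift (lift R)`.
    have e : Commute (P.lift (P.lift R)) (P.lift (G.sw m) * (G.dn (m + 1) * P.lift (G.sw m))) := by
      rw [← t.s₀_d₁_s₀]
      exact e₀.mul_right (e₁.mul_right e₀)
    have := congrArg (fun x => P.lift (G.sw m) * x * P.lift (G.sw m)) e.eq
    simp only [mul_assoc, t.pair₁.s_s, t.pair₁.ss, mul_one] at this
    rw [lift_mul, lift_mul]
    show _ * _ = _ * _
    simpa only [mul_assoc] using this
  induction h with
  | one => rw [lift_one]; exact Commute.one_left _
  | skip _ ih => exact skip ih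
  | add _ ih =>
    rw [lift_mul]
    exact (skip ih).mul_left (G.cnotTriple _).four

/-- This is `lift_commute_dn` conjugated by the last swap. -/
theorem Row.commute_cn {m : ℕ} {R : P.Hom (m + 1) (m + 1)} (h : G.Row m R) :
    Commute (G.sw m * (P.lift R * G.sw m)) (G.cn m) := by
  have p := G.cnotPair m
  have := congrArg (fun x => G.sw m * x * G.sw m) h.lift_commute_dn.eq
  rw [p.flip] at this
  simp only [mul_assoc, p.s_s, p.ss, mul_one] at this
  show _ * _ = _ * _
  simpa only [mul_assoc] using this

/-- Normal forms multiply as coefficient vectors over `𝔽₂` add, with `skip` for `0` and `add` for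
`1`: the outer gate `cn` commutes with the skipped part of the other factor, and two of them cancel.
-/
theorem Row.mul {m : ℕ} {R R' : P.Hom (m + 1) (m + 1)} (h : G.Row m R) (h' : G.Row m R') :
    G.Row m (R * R') := by
  induction h with
  | one => rwa [one_mul]
  | @skip m R hR ih =>
    have p := G.cnotPair m
    have key : ∀ R' : P.Hom (m + 1) (m + 1), G.sw m * (P.lift R * G.sw m) *
        (G.sw m * (P.lift R' * G.sw m)) = G.sw m * (P.lift (R * R') * G.sw m) := by
      intro R'
      rw [lift_mul]
      simp only [mul_assoc, p.s_s]
    cases h' with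
    | skip h' => rw [key]; exact (ih h').skip
    | add h' => rw [← mul_assoc, key]; exact (ih h').add
  | @add m R hR ih =>
    have p := G.cnotPair m
    have key : ∀ R' : P.Hom (m + 1) (m + 1), G.sw m * (P.lift R * G.sw m) *
        (G.sw m * (P.lift R' * G.sw m)) = G.sw m * (P.lift (R * R') * G.sw m) := by
      intro R'
      rw [lift_mul]
      simp only [mul_assoc, p.s_s]
    cases h' with
    | skip h' => rw [mul_assoc, ← h'.commute_cn.eq, ← mul_assoc, key]; exact (ih h').add
    | add h' =>
      rw [mul_assoc, ← mul_assoc (G.cn m), ← h'.commute_cn.eq, mul_assoc _ (G.cn m), p.cc, mul_one,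
        key]
      exact (ih h').skip

/-- The composite of the gates of `R` moved past two further wires, and of gates with the last
wire as target and these two wires as controls. -/
theorem Row.exists_two {m : ℕ} {R : P.Hom (m + 1 + 1 + 1) (m + 1 + 1 + 1)}
    (h : G.Row (m + 1 + 1) R) : ∃ Z : P.Hom (m + 1 + 1 + 1) (m + 1 + 1 + 1),
      (Commute (P.lift (G.sw m)) Z ∧ Commute (P.lift (G.cn m)) Z) ∧
      (G.Row (m + 1 + 1) Z ∧
        G.Row (m + 1 + 1) (Z * (G.sw (m + 1) * (P.lift (G.cn m) * G.sw (m + 1)))) ∧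
        G.Row (m + 1 + 1) (Z * G.cn (m + 1)) ∧
        G.Row (m + 1 + 1) (Z * (G.sw (m + 1) * (P.lift (G.cn m) * G.sw (m + 1)) * G.cn (m + 1)))) ∧
      (R = Z ∨ R = Z * (G.sw (m + 1) * (P.lift (G.cn m) * G.sw (m + 1))) ∨ R = Z * G.cn (m + 1) ∨
        R = Z * (G.sw (m + 1) * (P.lift (G.cn m) * G.sw (m + 1)) * G.cn (m + 1))) := by
  have t := G.cnotTriple m
  -- The 3-cycle of wires `sw (m + 1) * lift (sw m)` conjugates the commuting pair `lift (lift S)`,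
  -- `g₀` into the row with its last two controls skipped and `g₁`.
  have comm : ∀ (S : P.Hom (m + 1) (m + 1)) (g₀ g₁ : P.Hom (m + 1 + 1 + 1) (m + 1 + 1 + 1)),
      Commute (P.lift (P.lift S)) g₀ →
      G.sw (m + 1) * (P.lift (G.sw m) * g₀) = g₁ * (G.sw (m + 1) * P.lift (G.sw m)) →
      Commute g₁ (G.sw (m + 1) * (P.lift (G.sw m * (P.lift S * G.sw m)) * G.sw (m + 1))) := by
    intro S g₀ g₁ hS e
    have e' : g₀ * (P.lift (G.sw m) * G.sw (m + 1)) =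
        P.lift (G.sw m) * (G.sw (m + 1) * g₁) := by
      have := congrArg (fun x => P.lift (G.sw m) * (G.sw (m + 1) * x *
        (P.lift (G.sw m) * G.sw (m + 1)))) e
      simp only [mul_assoc, t.pair₀.s_s, t.pair₁.s_s, t.pair₀.ss, mul_one] at this
      exact this
    show _ = _
    rw [lift_mul, lift_mul]
    simp only [mul_assoc]
    rw [← mul_assoc (G.sw (m + 1)) (P.lift (G.sw m)), ← mul_assoc g₁, ← e,
      ← e']
    simp only [mul_assoc]
    rw [← mul_assoc g₀, ← hS.eq]
    simp only [mul_assoc]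
  have key : ∀ S : P.Hom (m + 1) (m + 1),
      G.sw (m + 1) * (P.lift (G.sw m * (P.lift S * G.sw m) * G.cn m) * G.sw (m + 1)) =
        G.sw (m + 1) * (P.lift (G.sw m * (P.lift S * G.sw m)) * G.sw (m + 1)) *
          (G.sw (m + 1) * (P.lift (G.cn m) * G.sw (m + 1))) := by
    intro S
    rw [lift_mul]
    simp only [mul_assoc, t.pair₀.s_s]
  have main : ∀ S : P.Hom (m + 1) (m + 1), G.Row m S →
      (fun Z => (Commute (P.lift (G.sw m)) Z ∧ Commute (P.lift (G.cn m)) Z) ∧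
      (G.Row (m + 1 + 1) Z ∧
        G.Row (m + 1 + 1) (Z * (G.sw (m + 1) * (P.lift (G.cn m) * G.sw (m + 1)))) ∧
        G.Row (m + 1 + 1) (Z * G.cn (m + 1)) ∧
        G.Row (m + 1 + 1)
          (Z * (G.sw (m + 1) * (P.lift (G.cn m) * G.sw (m + 1)) * G.cn (m + 1)))))
        (G.sw (m + 1) * (P.lift (G.sw m * (P.lift S * G.sw m)) * G.sw (m + 1))) := by
    intro S hS
    refine ⟨⟨comm S _ _ (G.lift_lift_sw S) t.braid, comm S _ _ (G.lift_lift_cn S) t.s₀_s₁_c₀⟩,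
      hS.skip.skip, ?_, hS.skip.add, ?_⟩
    · rw [← key]; exact hS.add.skip
    · rw [← mul_assoc, ← key]; exact hS.add.add
  cases h with
  | skip h =>
    cases h with
    | skip h => exact ⟨_, (main _ h).1, (main _ h).2, Or.inl rfl⟩
    | add h => exact ⟨_, (main _ h).1, (main _ h).2, Or.inr (Or.inl (key _))⟩
  | add h =>
    cases h with
    | skip h => exact ⟨_, (main _ h).1, (main _ h).2, Or.inr (Or.inr (Or.inl rfl))⟩
    | add h =>
      refine ⟨_, (main _ h).1, (main _ h).2, Or.inr (Or.inr (Or.inr ?_))⟩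
      rw [key, mul_assoc]

/-! ### Moving rows past words -/

/-- Composites of gates with the last wire as target can be moved past `f`. -/
def Pushes (G : P.Gates) {a b : ℕ} (f : P.Hom a b) : Prop :=
  ∀ R, G.Row b R → ∃ R', G.Row a R' ∧ P.lift f ⨾ R = R' ⨾ P.lift f

theorem Pushes.comp {a b c : ℕ} {f : P.Hom a b} {g : P.Hom b c} (hf : G.Pushes f)
    (hg : G.Pushes g) : G.Pushes (f ⨾ g) := by
  intro R hR
  obtain ⟨R₁, h₁, e₁⟩ := hg R hR
  obtain ⟨R₂, h₂, e₂⟩ := hf R₁ h₁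
  refine ⟨R₂, h₂, ?_⟩
  rw [lift_comp, P.assoc, e₁, ← P.assoc, e₂, P.assoc]

theorem Pushes.one (m : ℕ) : G.Pushes (1 : P.Hom m m) := by
  intro R hR
  refine ⟨R, hR, ?_⟩
  rw [lift_one]
  exact (one_mul R).trans (mul_one R).symm

/-- The swap and the gate on the last two wires do not meet `lift (lift f)`, so only the skipped
part of the row is affected. -/
theorem Pushes.lift {a b : ℕ} {f : P.Hom a b} (hf : G.Pushes f) : G.Pushes (P.lift f) := by
  have key : ∀ R R', P.lift f ⨾ R = R' ⨾ P.lift f →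
      P.lift (P.lift f) ⨾ (G.sw b * (P.lift R * G.sw b)) =
        (G.sw a * (P.lift R' * G.sw a)) ⨾ P.lift (P.lift f) := by
    intro R R' e
    have e' := congrArg P.lift e
    rw [lift_comp, lift_comp] at e'
    simp only [comp_mul, mul_comp, P.assoc]
    rw [← P.assoc _ (G.sw b), lift_lift_sw, P.assoc, ← P.assoc _ (P.lift R), e', P.assoc,
      lift_lift_sw]
  intro R hR
  cases hR with
  | skip h =>
    obtain ⟨R', hR', e⟩ := hf _ h
    exact ⟨_, hR'.skip, key _ _ e⟩
  | add h =>
    obtain ⟨R', hR', e⟩ := hf _ h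
    refine ⟨_, hR'.add, ?_⟩
    rw [comp_mul, key _ _ e, P.assoc, lift_lift_cn, ← P.assoc]
    rfl

/-- A gate controlled by the unit disappears by `lift_un_cn`; the rest of the row avoids the unit
wire. -/
theorem Pushes.un (m : ℕ) : G.Pushes (G.un m) := by
  have key : ∀ R, P.lift (G.un m) ⨾ (G.sw m * (P.lift R * G.sw m)) = R ⨾ P.lift (G.un m) := by
    intro R
    have p := G.cnotPair m
    have e : G.un (m + 1) ⨾ G.sw m ⨾ G.sw m = G.un (m + 1) :=
      (congrArg (P.comp (G.un (m + 1))) p.ss).trans (P.comp_id _)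
    simp only [comp_mul, P.assoc, lift_un_eq]
    rw [← P.assoc (G.sw m) (G.sw m), ← P.assoc (G.un (m + 1)), e, ← P.assoc, ← comp_un, P.assoc]
  intro R hR
  cases hR with
  | skip h => exact ⟨_, h, key _⟩
  | add h => exact ⟨_, h, by rw [comp_mul, key, P.assoc, lift_un_cn]⟩

/-- The linear form that the row adds to the target is pulled back along the gate. Only its
coefficients at the two wires next to the target matter, and here they are exchanged. -/
theorem Pushes.sw (m : ℕ) : G.Pushes (G.sw m) := by
  have t := G.cnotTriple m
  intro R hR
  obtain ⟨Z, ⟨hs, -⟩, ⟨h₁, h₂, h₃, h₄⟩, hR⟩ := hR.exists_two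
  have e : P.lift (G.sw m) * (G.sw (m + 1) * (P.lift (G.cn m) * G.sw (m + 1))) =
      G.cn (m + 1) * P.lift (G.sw m) := t.s₁_s₀_c₁
  have e' : P.lift (G.sw m) * G.cn (m + 1) =
      G.sw (m + 1) * (P.lift (G.cn m) * G.sw (m + 1)) * P.lift (G.sw m) := by
    rw [t.s₁_c₀]; simp only [mul_assoc]
  rcases hR with rfl | rfl | rfl | rfl
  · exact ⟨_, h₁, hs.eq⟩
  · exact ⟨_, h₃, (by rw [← mul_assoc, hs.eq, mul_assoc, e, mul_assoc] :
      P.lift (G.sw m) * (Z * _) = Z * _ * P.lift (G.sw m))⟩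
  · exact ⟨_, h₂, (by rw [← mul_assoc, hs.eq, mul_assoc, e', ← mul_assoc Z] :
      P.lift (G.sw m) * (Z * _) = Z * _ * P.lift (G.sw m))⟩
  · refine ⟨_, h₄, (?_ : P.lift (G.sw m) * (Z * _) = Z * _ * P.lift (G.sw m))⟩
    rw [← mul_assoc, hs.eq, mul_assoc, ← mul_assoc _ _ (G.cn (m + 1)), e, mul_assoc, e',
      ← mul_assoc (G.cn (m + 1)), ← t.c₀_comm]
    simp only [mul_assoc]

/-- With `x`, `y` the coordinates of the two wires next to the target, pulling back fixes the form
`x` and exchanges `y` with `x + y`. -/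
theorem Pushes.cn (m : ℕ) : G.Pushes (G.cn m) := by
  have t := G.cnotTriple m
  intro R hR
  obtain ⟨Z, ⟨-, hc⟩, ⟨h₁, h₂, h₃, h₄⟩, hR⟩ := hR.exists_two
  have e : P.lift (G.cn m) * (G.sw (m + 1) * (P.lift (G.cn m) * G.sw (m + 1))) =
      G.sw (m + 1) * (P.lift (G.cn m) * G.sw (m + 1)) * P.lift (G.cn m) := by
    rw [t.c₁_comm]; simp only [mul_assoc]
  have e' : P.lift (G.cn m) * G.cn (m + 1) =
      G.sw (m + 1) * (P.lift (G.cn m) * G.sw (m + 1)) * G.cn (m + 1) * P.lift (G.cn m) := by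
    rw [t.c₁_c₀]
    have := congrArg (· * P.lift (G.cn m)) t.c₀_comm
    simp only [mul_assoc] at this ⊢
    exact this.symm
  have e'' : P.lift (G.cn m) *
      (G.sw (m + 1) * (P.lift (G.cn m) * G.sw (m + 1)) * G.cn (m + 1)) =
      G.cn (m + 1) * P.lift (G.cn m) := by
    rw [← mul_assoc, e, mul_assoc, e']
    simp only [mul_assoc, t.pair₀.s_s, t.pair₁.c_c]
  rcases hR with rfl | rfl | rfl | rfl
  · exact ⟨_, h₁, hc.eq⟩
  · exact ⟨_, h₂, (by rw [← mul_assoc, hc.eq, mul_assoc, e, ← mul_assoc Z] :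
      P.lift (G.cn m) * (Z * _) = Z * _ * P.lift (G.cn m))⟩
  · exact ⟨_, h₄, (by rw [← mul_assoc, hc.eq, mul_assoc, e', ← mul_assoc Z] :
      P.lift (G.cn m) * (Z * _) = Z * _ * P.lift (G.cn m))⟩
  · exact ⟨_, h₃, (by rw [← mul_assoc, hc.eq, mul_assoc, e'', mul_assoc] :
      P.lift (G.cn m) * (Z * _) = Z * _ * P.lift (G.cn m))⟩

theorem Lin.pushes {m : ℕ} {f : P.Hom m m} (h : G.Lin m f) : G.Pushes f := by
  induction h with
  | one m => exact Pushes.one m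
  | mul _ _ ih ih' => exact ih.comp ih'
  | sw m => exact Pushes.sw m
  | cn m => exact Pushes.cn m
  | lift _ ih => exact ih.lift

theorem Incl.pushes {a b : ℕ} {f : P.Hom a b} (h : G.Incl a b f) : G.Pushes f := by
  induction h with
  | one => exact Pushes.one 0
  | un _ ih => exact ih.comp (Pushes.un _)
  | lift _ ih => exact ih.lift

end Gates
end PROP

namespace PROP

variable {P : PROP}

namespace Gates

variable {G : P.Gates}

/-! ### The coset decomposition -/

/-- The motive is extended by `True` to zero wires. The case `lift` has no induction hypothesis,
since there `f` has one wire less than the motive describes. -/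
theorem Lin.succ_induction {motive : ∀ m : ℕ, P.Hom (m + 1) (m + 1) → Prop}
    (one : ∀ m, motive m 1) (mul : ∀ m f g, motive m f → motive m g → motive m (f * g))
    (sw : ∀ m, motive (m + 1) (G.sw m)) (cn : ∀ m, motive (m + 1) (G.cn m))
    (lift : ∀ m f, G.Lin m f → motive m (P.lift f)) {m : ℕ} {g : P.Hom (m + 1) (m + 1)}
    (h : G.Lin (m + 1) g) : motive m g := by
  let motive' : ∀ m : ℕ, P.Hom m m → Prop := fun m =>
    match m with
    | 0 => fun _ => True
    | m + 1 => motive m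
  have key : ∀ (m : ℕ) (g : P.Hom m m), G.Lin m g → motive' m g := by
    intro m g h
    induction h with
    | one m =>
      cases m with
      | zero => trivial
      | succ m => exact one m
    | @mul m f g _ _ ih ih' =>
      cases m with
      | zero => trivial
      | succ m => exact mul m f g ih ih'
    | sw m => exact sw m
    | cn m => exact cn m
    | lift h _ => exact lift _ _ h
  exact key _ _ h

variable (G) in
/-- Words that fix the last basis vector. -/
def Stab (m : ℕ) (h : P.Hom (m + 1) (m + 1)) : Prop :=
  ∃ R f, G.Row m R ∧ G.Lin m f ∧ h = R * P.lift f

theorem Row.stab {m : ℕ} {R : P.Hom (m + 1) (m + 1)} (h : G.Row m R) : G.Stab m R :=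
  ⟨R, 1, h, Lin.one m, by rw [lift_one, mul_one]⟩

theorem Lin.stab {m : ℕ} {f : P.Hom m m} (h : G.Lin m f) : G.Stab m (P.lift f) :=
  ⟨1, f, Row.one' m, h, by rw [one_mul]⟩

/-- A semidirect product: `Lin.pushes` moves the second row left past the first lifted word. -/
theorem Stab.mul {m : ℕ} {h h' : P.Hom (m + 1) (m + 1)} (hh : G.Stab m h) (hh' : G.Stab m h') :
    G.Stab m (h * h') := by
  obtain ⟨R, f, hR, hf, rfl⟩ := hh
  obtain ⟨R', f', hR', hf', rfl⟩ := hh'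
  obtain ⟨R'', hR'', e⟩ := hf.pushes R' hR'
  refine ⟨R * R'', f * f', hR.mul hR'', hf.mul hf', ?_⟩
  have e' : P.lift f * R' = R'' * P.lift f := e
  rw [mul_assoc, ← mul_assoc (P.lift f), e', lift_mul]
  simp only [mul_assoc]

/-- The tail `lift (lift A)` does not meet a gate on the last two wires, so a three-wire identity
decides the product. -/
theorem coset_step {m : ℕ} {a a' g h : P.Hom (m + 1 + 1 + 1) (m + 1 + 1 + 1)}
    {b b' : P.Hom (m + 1 + 1) (m + 1 + 1)} {A : P.Hom (m + 1) (m + 1)}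
    (hg : P.lift (P.lift A) * g = g * P.lift (P.lift A))
    (e : a * (P.lift b * g) = h * (a' * P.lift b')) :
    a * P.lift (b * P.lift A) * g = h * (a' * P.lift (b' * P.lift A)) := by
  rw [lift_mul, lift_mul, mul_assoc, mul_assoc, hg, ← mul_assoc (P.lift b), ← mul_assoc a, e]
  simp only [mul_assoc]

/-- The coset table. A gate on the last two wires sees at most the first two letters of `A`; a
lifted word acts on the tail of `A`, which is a matter of one wire less. -/
theorem Coset.mul_lin {m : ℕ} {g : P.Hom (m + 1) (m + 1)} (hg : G.Lin (m + 1) g) :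
    ∀ A, G.Coset m A → ∃ h A', G.Stab m h ∧ G.Coset m A' ∧ A * g = h * A' := by
  -- The statement for one wire less is carried as a hypothesis and discharged in `main` by
  -- induction on `m`.
  have key : ∀ {m : ℕ} {g : P.Hom (m + 1) (m + 1)}, G.Lin (m + 1) g →
      (∀ k, m = k + 1 → ∀ g, G.Lin (k + 1) g →
        ∀ A, G.Coset k A → ∃ h A', G.Stab k h ∧ G.Coset k A' ∧ A * g = h * A') →
      ∀ A, G.Coset m A → ∃ h A', G.Stab m h ∧ G.Coset m A' ∧ A * g = h * A' := by
    intro m g hg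
    refine Lin.succ_induction (G := G) (motive := fun m g =>
      (∀ k, m = k + 1 → ∀ g, G.Lin (k + 1) g →
        ∀ A, G.Coset k A → ∃ h A', G.Stab k h ∧ G.Coset k A' ∧ A * g = h * A') →
      ∀ A, G.Coset m A → ∃ h A', G.Stab m h ∧ G.Coset m A' ∧ A * g = h * A') ?_ ?_ ?_ ?_ ?_ hg
    · exact fun m _ A hA => ⟨1, A, (Row.one' m).stab, hA, by rw [one_mul, mul_one]⟩
    · intro m f g ihf ihg hm A hA
      obtain ⟨h, A₁, hh, hA₁, e⟩ := ihf hm A hA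
      obtain ⟨h', A₂, hh', hA₂, e'⟩ := ihg hm A₁ hA₁
      exact ⟨h * h', A₂, hh.mul hh', hA₂, by rw [← mul_assoc, e, mul_assoc, e', mul_assoc]⟩
    · intro m _ A hA
      have p := G.cnotPair m
      cases hA with
      | one =>
        exact ⟨1, _, (Row.one' _).stab, (Coset.one m).sw, by rw [lift_one, mul_one]⟩
      | sw hA =>
        cases hA with
        | one => exact ⟨1, 1, (Row.one' _).stab, Coset.one _, by rw [lift_one, mul_one, p.ss, mul_one]⟩
        | @sw m A hA =>
          have t := G.cnotTriple m
          exact ⟨_, _, (Lin.sw m).stab, hA.sw.sw, coset_step (G.lift_lift_sw A) t.braid⟩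
        | @dn m A hA =>
          have t := G.cnotTriple m
          exact ⟨_, _, (Lin.sw m).stab, hA.sw.dn, coset_step (G.lift_lift_sw A) t.s₀_d₁_s₀⟩
      | dn hA =>
        cases hA with
        | one =>
          exact ⟨_, _, (Row.cn m).stab, (Coset.one m).dn, by
            rw [lift_one, mul_one, p.ds, p.sc]⟩
        | @sw m A hA =>
          have t := G.cnotTriple m
          exact ⟨_, _, (Lin.sw m).stab, hA.dn.sw, coset_step (G.lift_lift_sw A) t.d₀_s₁_s₀⟩
        | @dn m A hA =>
          have t := G.cnotTriple m
          exact ⟨_, _, (Row.cn (m + 1)).stab.mul (Lin.dn m).stab, hA.dn.dn,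
            coset_step (G.lift_lift_sw A) (t.d₀_d₁_s₀.trans (mul_assoc _ _ _).symm)⟩
    · intro m _ A hA
      have p := G.cnotPair m
      cases hA with
      | one =>
        exact ⟨_, _, (Row.cn m).stab, Coset.one _, by rw [one_mul, mul_one]⟩
      | sw hA =>
        cases hA with
        | one =>
          exact ⟨_, _, (Row.cn m).stab, (Coset.one m).dn, by
            rw [lift_one, mul_one, mul_one, p.sc]⟩
        | @sw m A hA =>
          have t := G.cnotTriple m
          exact ⟨_, _, (Lin.cn m).stab, hA.sw.sw, coset_step (G.lift_lift_cn A) t.s₀_s₁_c₀⟩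
        | @dn m A hA =>
          have t := G.cnotTriple m
          exact ⟨_, _, (Row.cn (m + 1)).stab, hA.dn.dn,
            coset_step (G.lift_lift_cn A) t.s₀_d₁_c₀⟩
      | dn hA =>
        cases hA with
        | one =>
          exact ⟨_, _, (Row.cn m).stab, (Coset.one m).sw, by
            rw [lift_one, mul_one, mul_one, p.dc]⟩
        | @sw m A hA =>
          have t := G.cnotTriple m
          exact ⟨_, _, (Row.cn m).skip.stab.mul (Lin.cn m).stab, hA.sw.dn,
            coset_step (G.lift_lift_cn A) (t.d₀_s₁_c₀.trans (by simp only [mul_assoc]))⟩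
        | @dn m A hA =>
          have t := G.cnotTriple m
          exact ⟨_, _, (Row.cn (m + 1)).stab, hA.dn.sw,
            coset_step (G.lift_lift_cn A) t.d₀_d₁_c₀⟩
    · intro m f hf hm A hA
      -- The first letter `a` of the representative has to pass `lift h`, where `h = R * lift g`:
      -- `sw` turns `lift R` into a skipped row, `dn` commutes with it, and both commute with `lift
      -- (lift g)`.
      have step : ∀ {k : ℕ} {f : P.Hom (k + 1) (k + 1)} {A h A' : P.Hom (k + 1) (k + 1)}
          {a b : P.Hom (k + 1 + 1) (k + 1 + 1)},
          A * f = h * A' → a * P.lift h = b * a →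
          a * P.lift A * P.lift f = b * (a * P.lift A') := by
        intro k f A h A' a b e e'
        rw [mul_assoc, ← lift_mul, e, lift_mul, ← mul_assoc, e', mul_assoc]
      cases hA with
      | one => exact ⟨_, _, hf.stab, Coset.one _, by rw [one_mul, mul_one]⟩
      | @sw m A hA =>
        obtain ⟨h, A', ⟨R, g, hR, hg, rfl⟩, hA', e⟩ := hm m rfl f hf A hA
        have p := G.cnotPair m
        have e₁ : P.lift (P.lift g) * G.sw m = G.sw m * P.lift (P.lift g) := G.lift_lift_sw g
        refine ⟨_, _, hR.skip.stab.mul hg.lift.stab, hA'.sw, step e ?_⟩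
        rw [lift_mul]
        simp only [mul_assoc]
        rw [e₁, p.s_s]
      | @dn m A hA =>
        obtain ⟨h, A', ⟨R, g, hR, hg, rfl⟩, hA', e⟩ := hm m rfl f hf A hA
        have e₁ : P.lift (P.lift g) * G.dn m = G.dn m * P.lift (P.lift g) := G.lift_lift_dn g
        refine ⟨_, _, (hR.lin.mul hg.lift).stab, hA'.dn, step e ?_⟩
        rw [lift_mul, mul_assoc, e₁, ← mul_assoc, ← hR.lift_commute_dn.eq, mul_assoc]
  have main : ∀ (m : ℕ) (g : P.Hom (m + 1) (m + 1)), G.Lin (m + 1) g →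
      ∀ A, G.Coset m A → ∃ h A', G.Stab m h ∧ G.Coset m A' ∧ A * g = h * A' := by
    intro m
    induction m with
    | zero => exact fun g hg => key hg (fun k hk => by omega)
    | succ m ih =>
      refine fun g hg => key hg (fun k hk => ?_)
      obtain rfl : m = k := by omega
      exact ih
  exact main m g hg

/-- Every word is the composite of a word that fixes the last basis vector and of a coset
representative. -/
theorem Lin.exists_coset {m : ℕ} {g : P.Hom (m + 1) (m + 1)} (hg : G.Lin (m + 1) g) :
    ∃ R f A, G.Row m R ∧ G.Lin m f ∧ G.Coset m A ∧ g = R * P.lift f * A := by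
  obtain ⟨h, A, ⟨R, f, hR, hf, rfl⟩, hA, e⟩ := Coset.mul_lin hg 1 (Coset.one m)
  exact ⟨R, f, A, hR, hf, hA, by rw [← e, one_mul]⟩

/-! ### Normal forms -/

/-- A swap exchanges two equal units, and a controlled-not has a unit as control. -/
theorem Incl.comp_lin {b : ℕ} {f : P.Hom 0 b} (hf : G.Incl 0 b f) {g : P.Hom b b}
    (hg : G.Lin b g) : f ⨾ g = f := by
  induction hg with
  | one m => exact P.comp_id f
  | mul _ _ ih ih' => rw [comp_mul, ih hf, ih' hf]
  | sw m =>
    cases hf with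
    | un hf =>
      cases hf with
      | un hf =>
        rw [P.assoc, P.assoc, ← lift_un_eq, ← comp_un, P.assoc]
  | cn m =>
    cases hf with
    | un hf =>
      cases hf with
      | un hf =>
        simp only [P.assoc]
        rw [← P.assoc (G.un m), comp_un (f := G.un m), P.assoc, lift_un_cn]
  | lift _ ih =>
    cases hf with
    | un hf => rw [P.assoc, ← comp_un, ← P.assoc, ih hf]

/-- Since `f` only adds units on the left, `g` reappears on the last `a` of the `b` wires. -/
theorem Lin.comp_incl {a b : ℕ} {g : P.Hom a a} (hg : G.Lin a g) {f : P.Hom a b}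
    (hf : G.Incl a b f) : ∃ g', G.Lin b g' ∧ g ⨾ f = f ⨾ g' := by
  induction hg generalizing b with
  | one m => exact ⟨1, Lin.one b, (P.id_comp f).trans (P.comp_id f).symm⟩
  | mul _ _ ih ih' =>
    obtain ⟨g₁, h₁, e₁⟩ := ih hf
    obtain ⟨g₂, h₂, e₂⟩ := ih' hf
    exact ⟨g₁ * g₂, h₁.mul h₂, by rw [mul_comp, e₂, ← P.assoc, e₁, comp_mul]⟩
  | sw m =>
    cases hf with
    | lift hf =>
      cases hf with
      | lift hf => exact ⟨_, Lin.sw _, (G.lift_lift_sw _).symm⟩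
  | cn m =>
    cases hf with
    | lift hf =>
      cases hf with
      | lift hf => exact ⟨_, Lin.cn _, (G.lift_lift_cn _).symm⟩
  | lift _ ih =>
    cases hf with
    | lift hf =>
      obtain ⟨g', h', e⟩ := ih hf
      exact ⟨_, h'.lift, by rw [← lift_comp, e, lift_comp]⟩

theorem Incl.comp {a b c : ℕ} {f : P.Hom a b} {g : P.Hom b c} (hf : G.Incl a b f)
    (hg : G.Incl b c g) : G.Incl a c (f ⨾ g) := by
  induction hf generalizing c with
  | one => rwa [P.id_comp]
  | un _ ih =>
    cases hg with
    | lift hg =>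
      rw [P.assoc, ← comp_un, ← P.assoc]
      exact (ih hg).un
  | lift _ ih =>
    cases hg with
    | lift hg => rw [← lift_comp]; exact (ih hg).lift

theorem Incl.id (a : ℕ) : G.Incl a a (P.id a) := by
  induction a with
  | zero => exact Incl.one
  | succ a ih => rw [← lift_id]; exact ih.lift

/-- `Incl` has its units on the left; swaps bring one to the right end. -/
theorem Incl.exists_un (a : ℕ) : ∃ f g, G.Incl a (a + 1) f ∧ G.Lin (a + 1) g ∧ G.un a = f ⨾ g := by
  induction a with
  | zero => exact ⟨_, _, Incl.one.un, Lin.one 1, by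
      rw [P.id_comp]; exact (P.comp_id _).symm⟩
  | succ a ih =>
    obtain ⟨f, g, hf, hg, e⟩ := ih
    refine ⟨_, _, hf.lift, hg.lift.mul (Lin.sw a), ?_⟩
    rw [comp_mul, ← lift_comp, ← e, lift_un_eq, P.assoc]
    exact ((congrArg (P.comp (G.un (a + 1))) (G.cnotPair a).ss).trans (P.comp_id _)).symm

/-! ### Not gates -/

theorem Nots.one' (m : ℕ) : G.Nots m 1 := by
  induction m with
  | zero => exact Nots.one
  | succ m ih => rw [← lift_one]; exact ih.skip

theorem Nots.nt' (m : ℕ) : G.Nots (m + 1) (G.nt m) := by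
  have := (Nots.one' (G := G) m).nt
  rwa [lift_one, one_mul] at this

theorem lift_mul_nt {m : ℕ} (f : P.Hom m m) : P.lift f * G.nt m = G.nt m * P.lift f := G.lift_nt f

theorem Nots.mul {m : ℕ} {N N' : P.Hom m m} (h : G.Nots m N) (h' : G.Nots m N') :
    G.Nots m (N * N') := by
  induction h with
  | one => rwa [one_mul]
  | skip _ ih =>
    cases h' with
    | skip h' => rw [← lift_mul]; exact (ih h').skip
    | nt h' => rw [← mul_assoc, ← lift_mul]; exact (ih h').nt
  | @nt m N _ ih =>
    cases h' with
    | skip h' => rw [mul_assoc, ← lift_mul_nt, ← mul_assoc, ← lift_mul]; exact (ih h').nt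
    | nt h' =>
      have e : G.nt m * G.nt m = 1 := G.nt_nt m
      rw [mul_assoc, ← mul_assoc (G.nt m), ← lift_mul_nt, mul_assoc _ (G.nt m), e, mul_one,
        ← lift_mul]
      exact (ih h').skip

theorem Nots.mul_self {m : ℕ} {N : P.Hom m m} (h : G.Nots m N) : N * N = 1 := by
  induction h with
  | one => exact one_mul _
  | skip _ ih => rw [← lift_mul, ih, lift_one]
  | @nt m N _ ih =>
    have e : G.nt m * G.nt m = 1 := G.nt_nt m
    rw [mul_assoc, ← mul_assoc (G.nt m), ← lift_mul_nt, mul_assoc _ (G.nt m), e, mul_one,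
      ← lift_mul, ih, lift_one]

theorem Nots.comp_incl {a b : ℕ} {N : P.Hom a a} (hN : G.Nots a N) {f : P.Hom a b}
    (hf : G.Incl a b f) : ∃ N', G.Nots b N' ∧ N ⨾ f = f ⨾ N' := by
  induction hN generalizing b with
  | one => exact ⟨1, Nots.one' b, (P.id_comp f).trans (P.comp_id f).symm⟩
  | skip _ ih =>
    cases hf with
    | lift hf =>
      obtain ⟨N', h', e⟩ := ih hf
      exact ⟨_, h'.skip, by rw [← lift_comp, e, lift_comp]⟩
  | nt _ ih =>
    cases hf with
    | lift hf =>
      obtain ⟨N', h', e⟩ := ih hf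
      exact ⟨_, h'.nt, by
        rw [mul_comp, ← lift_nt, ← P.assoc, ← lift_comp, e, lift_comp, comp_mul]⟩

/-- Translations are normalized by linear maps. For a gate on the last two wires only the nots on
these wires matter (`two`). -/
theorem Nots.mul_lin {m : ℕ} {N g : P.Hom m m} (hN : G.Nots m N) (hg : G.Lin m g) :
    ∃ N', G.Nots m N' ∧ N * g = g * N' := by
  have two : ∀ {k : ℕ} {g : P.Hom (k + 1 + 1) (k + 1 + 1)} {N : P.Hom (k + 1 + 1) (k + 1 + 1)},
      G.Nots (k + 1 + 1) N → (∀ f : P.Hom k k, P.lift (P.lift f) * g = g * P.lift (P.lift f)) →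
      (∃ N', G.Nots _ N' ∧ G.nt (k + 1) * g = g * N') →
      (∃ N', G.Nots _ N' ∧ P.lift (G.nt k) * g = g * N') → ∃ N', G.Nots _ N' ∧ N * g = g * N' := by
    rintro k g N hN hf ⟨N₀, h₀, e₀⟩ ⟨N₁, h₁, e₁⟩
    cases hN with
    | skip hN =>
      cases hN with
      | skip hN => exact ⟨_, hN.skip.skip, hf _⟩
      | nt hN => exact ⟨_, hN.skip.skip.mul h₁, by
          rw [lift_mul, mul_assoc, e₁, ← mul_assoc, hf, mul_assoc]⟩
    | nt hN =>
      cases hN with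
      | skip hN => exact ⟨_, hN.skip.skip.mul h₀, by rw [mul_assoc, e₀, ← mul_assoc, hf, mul_assoc]⟩
      | nt hN => exact ⟨_, (hN.skip.skip.mul h₁).mul h₀, by
          rw [lift_mul, mul_assoc, e₀, mul_assoc, ← mul_assoc _ g, e₁, ← mul_assoc, ← mul_assoc, hf]
          simp only [mul_assoc]⟩
  induction hg with
  | one m => exact ⟨N, hN, by rw [one_mul, mul_one]⟩
  | mul _ _ ih ih' =>
    obtain ⟨N₁, h₁, e₁⟩ := ih hN
    obtain ⟨N₂, h₂, e₂⟩ := ih' h₁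
    exact ⟨N₂, h₂, by rw [← mul_assoc, e₁, mul_assoc, e₂, mul_assoc]⟩
  | sw m =>
    exact two hN (fun f => G.lift_lift_sw f) ⟨_, (Nots.nt' m).skip, G.nt_sw m⟩
      ⟨_, Nots.nt' (m + 1), G.lift_nt_sw m⟩
  | cn m =>
    exact two hN (fun f => G.lift_lift_cn f) ⟨_, Nots.nt' (m + 1), G.nt_cn m⟩
      ⟨_, (Nots.nt' m).nt, G.lift_nt_cn m⟩
  | @lift m g _ ih =>
    cases hN with
    | skip hN =>
      obtain ⟨N', h', e⟩ := ih hN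
      exact ⟨_, h'.skip, by rw [← lift_mul, e, lift_mul]⟩
    | nt hN =>
      obtain ⟨N', h', e⟩ := ih hN
      exact ⟨_, h'.nt, by
        rw [mul_assoc, ← lift_mul_nt, ← mul_assoc, ← lift_mul, e, lift_mul, mul_assoc]⟩

variable (G) in
/-- Words of all gates. -/
inductive Word : ∀ a b : ℕ, P.Hom a b → Prop
  | id (a : ℕ) : Word a a (P.id a)
  | comp {a b c : ℕ} {f : P.Hom a b} {g : P.Hom b c} : Word a b f → Word b c g → Word a c (f ⨾ g)
  | sw (m : ℕ) : Word (m + 1 + 1) (m + 1 + 1) (G.sw m)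
  | cn (m : ℕ) : Word (m + 1 + 1) (m + 1 + 1) (G.cn m)
  | nt (m : ℕ) : Word (m + 1) (m + 1) (G.nt m)
  | un (m : ℕ) : Word m (m + 1) (G.un m)
  | lift {a b : ℕ} {f : P.Hom a b} : Word a b f → Word (a + 1) (b + 1) (P.lift f)

theorem Word.exists_normal {a b : ℕ} {w : P.Hom a b} (h : G.Word a b w) :
    ∃ f g N, G.Incl a b f ∧ G.Lin b g ∧ G.Nots b N ∧ w = f ⨾ (g * N) := by
  induction h with
  | id a => exact ⟨_, _, _, Incl.id a, Lin.one a, Nots.one' a, by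
      rw [one_mul]; exact (P.id_comp _).symm⟩
  | comp _ _ ih ih' =>
    obtain ⟨f, g, N, hf, hg, hN, rfl⟩ := ih
    obtain ⟨f', g', N', hf', hg', hN', rfl⟩ := ih'
    -- `N` and `g` pass to the right of `f'`; then the new nots pass `g'`.
    obtain ⟨N₁, h₁, e₁⟩ := hN.comp_incl hf'
    obtain ⟨g₁, k₁, e₂⟩ := hg.comp_incl hf'
    obtain ⟨N₂, h₂, e₃⟩ := h₁.mul_lin hg'
    refine ⟨_, _, _, hf.comp hf', k₁.mul hg', h₂.mul hN', ?_⟩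
    have e₄ : (g * N) ⨾ f' ⨾ (g' * N') = f' ⨾ (g₁ * (N₁ * (g' * N'))) := by
      rw [mul_comp, ← P.assoc N, e₁, P.assoc, ← P.assoc g, e₂, P.assoc]
      rfl
    rw [P.assoc, e₄, ← mul_assoc N₁, e₃, ← P.assoc]
    simp only [mul_assoc]
  | sw m => exact ⟨_, _, _, Incl.id _, Lin.sw m, Nots.one' _, by
      rw [mul_one]; exact (P.id_comp _).symm⟩
  | cn m => exact ⟨_, _, _, Incl.id _, Lin.cn m, Nots.one' _, by
      rw [mul_one]; exact (P.id_comp _).symm⟩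
  | nt m => exact ⟨_, _, _, Incl.id _, Lin.one _, Nots.nt' m, by
      rw [one_mul]; exact (P.id_comp _).symm⟩
  | un m =>
    obtain ⟨f, g, hf, hg, e⟩ := Incl.exists_un (G := G) m
    exact ⟨f, g, 1, hf, hg, Nots.one' _, by rw [mul_one, e]⟩
  | lift _ ih =>
    obtain ⟨f, g, N, hf, hg, hN, rfl⟩ := ih
    exact ⟨_, _, _, hf.lift, hg.lift, hN.skip, by rw [lift_comp, lift_mul]⟩

end Gates
end PROP

/-! ### The action of words on vectors -/

namespace AffMat

/-- A vector with one more coordinate on the right. -/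
def snoc {n : ℕ} (v : Fin n → ZMod 2) (x : ZMod 2) : Fin (n + 1) → ZMod 2 :=
  Fin.append v (fun _ : Fin 1 => x)

theorem snoc_castAdd {n : ℕ} (v : Fin n → ZMod 2) (x : ZMod 2) (i : Fin n) :
    snoc v x (Fin.castAdd 1 i) = v i := Fin.append_left _ _ _

theorem snoc_natAdd {n : ℕ} (v : Fin n → ZMod 2) (x : ZMod 2) (i : Fin 1) :
    snoc v x (Fin.natAdd n i) = x := Fin.append_right _ _ _

theorem snoc_inj {n : ℕ} {v w : Fin n → ZMod 2} {x y : ZMod 2} :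
    snoc v x = snoc w y ↔ v = w ∧ x = y := by
  constructor
  · intro h
    refine ⟨funext fun i => ?_, ?_⟩
    · have := congrFun h (Fin.castAdd 1 i)
      rwa [snoc_castAdd, snoc_castAdd] at this
    · have := congrFun h (Fin.natAdd n (0 : Fin 1))
      rwa [snoc_natAdd, snoc_natAdd] at this
  · rintro ⟨rfl, rfl⟩; rfl

theorem exists_snoc {n : ℕ} (w : Fin (n + 1) → ZMod 2) : ∃ v x, w = snoc v x := by
  refine ⟨fun i => w (Fin.castAdd 1 i), w (Fin.natAdd n (0 : Fin 1)), funext fun i => ?_⟩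
  refine Fin.addCases (fun i => ?_) (fun i => ?_) i
  · rw [snoc_castAdd]
  · rw [snoc_natAdd, Subsingleton.elim i 0]

theorem snoc_add {n : ℕ} (v w : Fin n → ZMod 2) (x y : ZMod 2) :
    snoc v x + snoc w y = snoc (v + w) (x + y) := by
  funext i
  refine Fin.addCases (fun i => ?_) (fun i => ?_) i <;>
    simp only [Pi.add_apply, snoc_castAdd, snoc_natAdd]

theorem snoc_zero (n : ℕ) : snoc (0 : Fin n → ZMod 2) 0 = 0 := by
  funext i
  refine Fin.addCases (fun i => ?_) (fun i => ?_) i <;>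
    simp only [Pi.zero_apply, snoc_castAdd, snoc_natAdd]

theorem snoc_snoc {n : ℕ} (v : Fin n → ZMod 2) (x y : ZMod 2) :
    snoc (snoc v x) y = Fin.append v (snoc (fun _ : Fin 1 => x) y) :=
  Fin.append_assoc v (fun _ : Fin 1 => x) (fun _ : Fin 1 => y)

theorem eq_zero_or_one : ∀ x : ZMod 2, x = 0 ∨ x = 1 := by decide

theorem app_cnot_snoc : ∀ x y : ZMod 2,
    cnot.app (snoc (fun _ : Fin 1 => x) y) = snoc (fun _ : Fin 1 => x) (x + y) := by decide

theorem app_not : ∀ x : ZMod 2, not.app (fun _ : Fin 1 => x) = (fun _ : Fin 1 => x + 1) := by decide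

theorem app_zero (v : Fin 0 → ZMod 2) : zero.app v = fun _ : Fin 1 => 0 := by
  funext i
  simp [zero, app]

end AffMat

namespace PROP

open AffMat

variable {P : PROP}

/-- The standard interpretation of a prop with gates. -/
structure Gates.Interp (G : P.Gates) where
  toMor : P ⟶ MonoAffMat
  map_c : (toMor.map G.c).1 = AffMat.cnot
  map_u : (toMor.map G.u).1 = AffMat.zero
  map_n : (toMor.map G.n).1 = AffMat.not

namespace Gates.Interp

variable {G : P.Gates} (I : G.Interp)

/-- The affine map that interprets a map. -/
def act {a b : ℕ} (f : P.Hom a b) (v : Fin a → ZMod 2) : Fin b → ZMod 2 := (I.toMor.map f).1.app v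

theorem act_injective {a b : ℕ} (f : P.Hom a b) : Function.Injective (I.act f) :=
  (isMono_iff _).1 (I.toMor.map f).2

theorem map_eq_iff {a b : ℕ} {f : P.Hom a b} {g : MonoAffMat.Hom a b} :
    I.toMor.map f = g ↔ ∀ v, I.act f v = g.1.app v :=
  ⟨fun h v => by rw [← h]; rfl, fun h => Subtype.ext (app_injective h)⟩

theorem act_id {a : ℕ} (v : Fin a → ZMod 2) : I.act (P.id a) v = v := by
  unfold act
  rw [I.toMor.map_id]
  exact app_id v

theorem act_one {a : ℕ} (v : Fin a → ZMod 2) : I.act (1 : P.Hom a a) v = v := I.act_id v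

theorem act_comp {a b c : ℕ} (f : P.Hom a b) (g : P.Hom b c) (v : Fin a → ZMod 2) :
    I.act (f ⨾ g) v = I.act g (I.act f v) := by
  unfold act
  rw [I.toMor.map_comp]
  exact app_comp _ _ v

theorem act_mul {a : ℕ} (f g : P.Hom a a) (v : Fin a → ZMod 2) :
    I.act (f * g) v = I.act g (I.act f v) := I.act_comp f g v

theorem act_tensor {a b c d : ℕ} (f : P.Hom a b) (g : P.Hom c d) (v : Fin a → ZMod 2)
    (w : Fin c → ZMod 2) :
    I.act (P.tensor f g) (Fin.append v w) = Fin.append (I.act f v) (I.act g w) := by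
  unfold act
  rw [I.toMor.map_tensor]
  exact app_tensor _ _ v w

theorem act_lift {a b : ℕ} (f : P.Hom a b) (v : Fin a → ZMod 2) (x : ZMod 2) :
    I.act (P.lift f) (snoc v x) = snoc (I.act f v) x :=
  (I.act_tensor f (P.id 1) v _).trans (congrArg (Fin.append (I.act f v)) (I.act_id _))

theorem act_whisk (m : ℕ) {a b : ℕ} (f : P.Hom a b) (v : Fin m → ZMod 2) (w : Fin a → ZMod 2) :
    I.act (P.whisk m f) (Fin.append v w) = Fin.append v (I.act f w) :=
  (I.act_tensor (P.id m) f v w).trans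
    (congrArg (fun t => Fin.append t (I.act f w)) (I.act_id v))

theorem act_sw (m : ℕ) (v : Fin m → ZMod 2) (x y : ZMod 2) :
    I.act (G.sw m) (snoc (snoc v x) y) = snoc (snoc v y) x := by
  rw [snoc_snoc, snoc_snoc]
  refine (I.act_whisk m P.swap v _).trans (congrArg _ ?_)
  unfold act swap
  rw [I.toMor.map_symm]
  exact app_symm _ _

theorem act_cn (m : ℕ) (v : Fin m → ZMod 2) (x y : ZMod 2) :
    I.act (G.cn m) (snoc (snoc v x) y) = snoc (snoc v x) (x + y) := by
  rw [snoc_snoc, snoc_snoc]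
  refine (I.act_whisk m G.c v _).trans (congrArg _ ?_)
  unfold act
  rw [I.map_c]
  exact app_cnot_snoc _ _

theorem act_dn (m : ℕ) (v : Fin m → ZMod 2) (x y : ZMod 2) :
    I.act (G.dn m) (snoc (snoc v x) y) = snoc (snoc v (x + y)) y := by
  rw [dn_eq, act_comp, act_comp, act_sw, act_cn, act_sw, add_comm y x]

theorem act_nt (m : ℕ) (v : Fin m → ZMod 2) (x : ZMod 2) :
    I.act (G.nt m) (snoc v x) = snoc v (x + 1) := by
  refine (I.act_whisk m G.n v _).trans (congrArg _ ?_)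
  unfold act
  rw [I.map_n]
  exact app_not _

theorem act_un (m : ℕ) (v : Fin m → ZMod 2) : I.act (G.un m) v = snoc v 0 := by
  have h := I.act_whisk m G.u v ![]
  rw [Fin.append_right_nil v ![] rfl] at h
  refine (h : I.act (G.un m) v = _).trans (congrArg _ ?_)
  unfold act
  rw [I.map_u]
  exact app_zero _

/-! ### Linearity, and normal forms that act trivially -/

theorem act_lin_add {m : ℕ} {g : P.Hom m m} (hg : G.Lin m g) (v w : Fin m → ZMod 2) :
    I.act g (v + w) = I.act g v + I.act g w := by
  induction hg with
  | one m => simp only [act_one]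
  | mul _ _ ih ih' => simp only [act_mul, ih, ih']
  | sw m =>
    obtain ⟨v, y, rfl⟩ := exists_snoc v
    obtain ⟨v, x, rfl⟩ := exists_snoc v
    obtain ⟨w, y', rfl⟩ := exists_snoc w
    obtain ⟨w, x', rfl⟩ := exists_snoc w
    simp only [snoc_add, act_sw]
  | cn m =>
    obtain ⟨v, y, rfl⟩ := exists_snoc v
    obtain ⟨v, x, rfl⟩ := exists_snoc v
    obtain ⟨w, y', rfl⟩ := exists_snoc w
    obtain ⟨w, x', rfl⟩ := exists_snoc w
    simp only [snoc_add, act_cn, add_add_add_comm]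
  | lift _ ih =>
    obtain ⟨v, y, rfl⟩ := exists_snoc v
    obtain ⟨w, y', rfl⟩ := exists_snoc w
    simp only [snoc_add, act_lift, ih]

theorem act_lin_zero {m : ℕ} {g : P.Hom m m} (hg : G.Lin m g) : I.act g 0 = 0 := by
  have := I.act_lin_add hg 0 0
  rwa [add_zero, left_eq_add] at this

theorem act_incl_add {a b : ℕ} {f : P.Hom a b} (hf : G.Incl a b f) (v w : Fin a → ZMod 2) :
    I.act f (v + w) = I.act f v + I.act f w := by
  induction hf with
  | one => simp only [act_id]
  | un _ ih =>
    simp only [act_comp, act_un, ih, snoc_add, add_zero]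
  | lift _ ih =>
    obtain ⟨v, y, rfl⟩ := exists_snoc v
    obtain ⟨w, y', rfl⟩ := exists_snoc w
    simp only [snoc_add, act_lift, ih]

theorem act_incl_zero {a b : ℕ} {f : P.Hom a b} (hf : G.Incl a b f) : I.act f 0 = 0 := by
  have := I.act_incl_add hf 0 0
  rwa [add_zero, left_eq_add] at this

theorem act_row {m : ℕ} {R : P.Hom (m + 1) (m + 1)} (hR : G.Row m R) :
    ∀ v, ∃ r, ∀ x, I.act R (snoc v x) = snoc v (x + r) := by
  induction hR with
  | one => exact fun v => ⟨0, fun x => by rw [act_one, add_zero]⟩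
  | skip _ ih =>
    intro v
    obtain ⟨v, y, rfl⟩ := exists_snoc v
    obtain ⟨r, hr⟩ := ih v
    exact ⟨r, fun x => by rw [act_mul, act_mul, act_sw, act_lift, hr, act_sw]⟩
  | add _ ih =>
    intro v
    obtain ⟨v, y, rfl⟩ := exists_snoc v
    obtain ⟨r, hr⟩ := ih v
    exact ⟨y + r, fun x => by
      rw [act_mul, act_mul, act_mul, act_sw, act_lift, hr, act_sw, act_cn]
      congr 1; ring⟩

theorem row_eq_one {m : ℕ} {R : P.Hom (m + 1) (m + 1)} (hR : G.Row m R)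
    (h : ∀ v, I.act R v = v) : R = 1 := by
  induction hR with
  | one => rfl
  | @skip m R _ ih =>
    have h' : ∀ v, I.act R v = v := by
      intro v
      obtain ⟨v, x, rfl⟩ := exists_snoc v
      have := h (snoc (snoc v 0) x)
      rw [act_mul, act_mul, act_sw, act_lift] at this
      obtain ⟨w, y, hw⟩ := exists_snoc (I.act R (snoc v x))
      rw [hw, act_sw, snoc_inj, snoc_inj] at this
      rw [hw, this.1.1, this.2]
    rw [ih h', lift_one, one_mul, (G.cnotPair m).ss]
  | @add m R hR _ =>
    exfalso
    -- Only the control of the outermost gate carries a `1`, so the target is flipped.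
    have := h (snoc (snoc 0 1) 0)
    rw [act_mul, act_mul, act_mul, act_sw, act_lift, snoc_zero, I.act_lin_zero hR.lin, ← snoc_zero,
      act_sw, act_cn, snoc_inj] at this
    exact absurd this.2 (by decide)

/-- The constructor `sw` sends the last basis vector to a vector with last coordinate `0`, and `dn`
to one with nonzero initial part. -/
theorem coset_eq_one {m : ℕ} {A : P.Hom (m + 1) (m + 1)} (hA : G.Coset m A)
    (h : I.act A (snoc 0 1) = snoc 0 1) : A = 1 := by
  cases hA with
  | one => rfl
  | sw hA =>
    exfalso
    rw [act_mul, ← snoc_zero, act_sw, act_lift, snoc_inj] at h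
    exact absurd h.2 (by decide)
  | dn hA =>
    exfalso
    rw [act_mul, ← snoc_zero, act_dn, act_lift, snoc_inj, snoc_zero, ← I.act_lin_zero hA.lin] at h
    have := I.act_injective _ h.1
    rw [← snoc_zero, snoc_inj] at this
    exact absurd this.2 (by decide)

theorem nots_eq_one {m : ℕ} {N : P.Hom m m} (hN : G.Nots m N) (h : I.act N 0 = 0) : N = 1 := by
  induction hN with
  | one => rfl
  | skip _ ih =>
    rw [← snoc_zero, act_lift, snoc_inj] at h
    rw [ih h.1, lift_one]
  | nt _ ih =>
    rw [← snoc_zero, act_mul, act_lift, act_nt, snoc_inj] at h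
    exact absurd h.2 (by decide)

theorem exists_nots {m : ℕ} (t : Fin m → ZMod 2) :
    ∃ N, G.Nots m N ∧ ∀ v, I.act N v = v + t := by
  induction m with
  | zero => exact ⟨1, Nots.one, fun v => Subsingleton.elim _ _⟩
  | succ m ih =>
    obtain ⟨t, x, rfl⟩ := exists_snoc t
    obtain ⟨N, hN, h⟩ := ih t
    have hx := eq_zero_or_one x
    rcases hx with rfl | rfl
    · refine ⟨_, hN.skip, fun v => ?_⟩
      obtain ⟨v, y, rfl⟩ := exists_snoc v
      rw [act_lift, h, snoc_add, add_zero]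
    · refine ⟨_, hN.nt, fun v => ?_⟩
      obtain ⟨v, y, rfl⟩ := exists_snoc v
      rw [act_mul, act_lift, act_nt, h, snoc_add]

/-! ### Faithfulness -/

theorem incl_comp_lin {a b : ℕ} {f : P.Hom a b} (hf : G.Incl a b f) {g : P.Hom b b}
    (hg : G.Lin b g) (h : ∀ v, I.act g (I.act f v) = I.act f v) : f ⨾ g = f := by
  induction hf with
  | one => exact hg.zero ▸ P.comp_id _
  | un hf _ => exact hf.un.comp_lin hg
  | @lift a b f hf ih =>
    obtain ⟨R, g, A, hR, hg', hA, rfl⟩ := hg.exists_coset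
    -- The last basis vector lies in the image of `lift f`, so the product fixes it; `R` and `lift
    -- g` fix it as well, hence so does `A`.
    have e₀ : I.act (P.lift f) (snoc 0 1) = snoc 0 1 := by
      rw [act_lift, I.act_incl_zero hf]
    have hA1 : A = 1 := by
      refine I.coset_eq_one hA ?_
      have := h (snoc 0 1)
      obtain ⟨r, hr⟩ := I.act_row hR 0
      have hr0 : r = 0 := by
        have h0 := I.act_lin_zero hR.lin
        rw [← snoc_zero, hr, snoc_inj] at h0
        simpa using h0.2
      rw [e₀, act_mul, act_mul, hr, act_lift, I.act_lin_zero hg', hr0, add_zero] at this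
      exact this
    subst hA1
    -- `R` is known to act trivially only on the image of `lift f`; on the source side, `R'` acts
    -- trivially on all vectors.
    obtain ⟨R', hR', e⟩ := hf.pushes R hR
    have e₁ : P.lift f ⨾ (R * P.lift g * 1) = R' ⨾ P.lift (f ⨾ g) := by
      rw [mul_one, comp_mul, e, P.assoc, lift_comp]
    have h₁ : ∀ v x, I.act f v = I.act g (I.act f v) ∧ I.act R' (snoc v x) = snoc v x := by
      intro v x
      have := h (snoc v x)
      rw [← act_comp, e₁, act_comp] at this
      obtain ⟨r, hr⟩ := I.act_row hR' v
      rw [hr, act_lift, act_lift, act_comp, snoc_inj] at this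
      exact ⟨this.1.symm, by rw [hr, this.2]⟩
    have hR1 : R' = 1 := by
      refine I.row_eq_one hR' fun v => ?_
      obtain ⟨v, x, rfl⟩ := exists_snoc v
      exact (h₁ v x).2
    rw [e₁, hR1, ih hg' fun v => (h₁ v 0).1.symm]
    exact P.id_comp _

theorem incl_unique {a b : ℕ} {f f' : P.Hom a b} (hf : G.Incl a b f) (hf' : G.Incl a b f') :
    f = f' := by
  induction hf with
  | one => cases hf' with
    | one => rfl
  | un _ ih => cases hf' with
    | un h => rw [ih h]
  | lift _ ih => cases hf' with
    | lift h => rw [ih h]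

theorem word_ext {a b : ℕ} {w w' : P.Hom a b} (hw : G.Word a b w) (hw' : G.Word a b w')
    (h : ∀ v, I.act w v = I.act w' v) : w = w' := by
  obtain ⟨f, g, N, hf, hg, hN, rfl⟩ := hw.exists_normal
  obtain ⟨f', g', N', hf', hg', hN', rfl⟩ := hw'.exists_normal
  obtain rfl := incl_unique hf hf'
  -- At `0` only the translations contribute.
  have hNN : N * N' = 1 := by
    refine I.nots_eq_one (hN.mul hN') ?_
    have := h 0
    rw [act_comp, act_comp, act_mul, act_mul, I.act_incl_zero hf, I.act_lin_zero hg,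
      I.act_lin_zero hg'] at this
    rw [act_mul, this, ← act_mul, hN'.mul_self, act_one]
  have hNe : N = N' := by
    rw [← mul_one N, ← hN'.mul_self, ← mul_assoc, hNN, one_mul]
  subst hNe
  obtain ⟨k, hk, e₁, e₂⟩ := hg'.exists_inv
  have key : f ⨾ (g * k) = f := by
    refine I.incl_comp_lin hf (hg.mul hk) fun v => ?_
    have := h v
    rw [act_comp, act_comp, act_mul, act_mul] at this
    rw [act_mul, I.act_injective _ this, ← act_mul, e₁, act_one]
  have e : f ⨾ g = f ⨾ g' := by
    conv_rhs => rw [← key, ← comp_mul, mul_assoc, e₂, mul_one]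
  rw [comp_mul, comp_mul, e]

/-! ### Fullness -/

theorem word_of_lin {m : ℕ} {g : P.Hom m m} (hg : G.Lin m g) : G.Word m m g := by
  induction hg with
  | one m => exact Word.id m
  | mul _ _ ih ih' => exact ih.comp ih'
  | sw m => exact Word.sw m
  | cn m => exact Word.cn m
  | lift _ ih => exact ih.lift

theorem word_of_nots {m : ℕ} {N : P.Hom m m} (hN : G.Nots m N) : G.Word m m N := by
  induction hN with
  | one => exact Word.id 0
  | skip _ ih => exact ih.lift
  | nt _ ih => exact ih.lift.comp (Word.nt _)

theorem word_of_incl {a b : ℕ} {f : P.Hom a b} (hf : G.Incl a b f) : G.Word a b f := by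
  induction hf with
  | one => exact Word.id 0
  | un _ ih => exact ih.comp (Word.un _)
  | lift _ ih => exact ih.lift

/-- If the initial part of `v` vanishes, `v` is the last basis vector; otherwise the last coordinate
selects `sw` or `dn`. -/
theorem exists_coset {m : ℕ} (v : Fin (m + 1) → ZMod 2) (hv : v ≠ 0) :
    ∃ A, G.Coset m A ∧ I.act A (snoc 0 1) = v := by
  induction m with
  | zero =>
    refine ⟨1, Coset.one 0, ?_⟩
    obtain ⟨w, x, rfl⟩ := exists_snoc v
    obtain rfl : w = 0 := Subsingleton.elim _ _
    have hx := eq_zero_or_one x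
    rcases hx with rfl | rfl
    · exact absurd (snoc_zero 0) hv
    · exact I.act_one _
  | succ m ih =>
    obtain ⟨w, x, rfl⟩ := exists_snoc v
    have hx := eq_zero_or_one x
    by_cases hw : w = 0
    · subst hw
      rcases hx with rfl | rfl
      · exact absurd (snoc_zero _) hv
      · exact ⟨1, Coset.one _, I.act_one _⟩
    · obtain ⟨A, hA, e⟩ := ih w hw
      rcases hx with rfl | rfl
      · exact ⟨_, hA.sw, by rw [act_mul, ← snoc_zero, act_sw, act_lift, e]⟩
      · exact ⟨_, hA.dn, by rw [act_mul, ← snoc_zero, act_dn, act_lift, zero_add, e]⟩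

/-- The coefficient of `r` at the last control selects `skip` or `add`. Over `𝔽₂` additive maps are
linear. -/
theorem exists_row {m : ℕ} (r : (Fin m → ZMod 2) →+ ZMod 2) :
    ∃ R, G.Row m R ∧ ∀ v x, I.act R (snoc v x) = snoc v (x + r v) := by
  induction m with
  | zero =>
    refine ⟨1, Row.one, fun v x => ?_⟩
    rw [Subsingleton.elim v 0, map_zero, act_one, add_zero]
  | succ m ih =>
    obtain ⟨R, hR, h⟩ := ih (r.comp ⟨⟨fun v => snoc v 0, snoc_zero m⟩, fun v w => by
      rw [snoc_add, add_zero]⟩)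
    have hr : ∀ v y, r (snoc v y) = r (snoc v 0) + y * r (snoc 0 1) := by
      intro v y
      have hy := eq_zero_or_one y
      rcases hy with rfl | rfl
      · rw [zero_mul, add_zero]
      · rw [one_mul, ← map_add, snoc_add, add_zero, zero_add]
    replace h : ∀ v x, I.act R (snoc v x) = snoc v (x + r (snoc v 0)) := h
    have hb := eq_zero_or_one (r (snoc 0 1))
    rcases hb with hb | hb
    · refine ⟨_, hR.skip, fun v x => ?_⟩
      obtain ⟨v, y, rfl⟩ := exists_snoc v
      rw [act_mul, act_mul, act_sw, act_lift, h, act_sw, hr v y, hb, mul_zero, add_zero]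
    · refine ⟨_, hR.add, fun v x => ?_⟩
      obtain ⟨v, y, rfl⟩ := exists_snoc v
      rw [act_mul, act_mul, act_mul, act_sw, act_lift, h, act_sw, act_cn, hr v y, hb]
      congr 1; ring

/-- Gaussian elimination on the last column: a coset representative `A` carries the last basis
vector to that column, and undoing `A` leaves a block triangular map. Its last row is a `Row`, and
its upper block has one column less. -/
theorem exists_word_of_additive {a b : ℕ} (f : (Fin a → ZMod 2) →+ (Fin b → ZMod 2))
    (hf : Function.Injective f) : ∃ w, G.Word a b w ∧ ∀ v, I.act w v = f v := by
  induction a generalizing b with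
  | zero =>
    have key : ∃ w, G.Incl 0 b w := by
      clear hf f
      induction b with
      | zero => exact ⟨_, Incl.one⟩
      | succ b ih => exact ⟨_, ih.choose_spec.un⟩
    obtain ⟨w, hw⟩ := key
    refine ⟨w, word_of_incl hw, fun v => ?_⟩
    rw [Subsingleton.elim v 0, I.act_incl_zero hw, map_zero]
  | succ a ih =>
    have hne : f (snoc 0 1) ≠ 0 := by
      rw [← map_zero f]
      intro h
      have := hf h
      rw [← snoc_zero, snoc_inj] at this
      exact absurd this.2 (by decide)
    cases b with
    | zero => exact absurd (Subsingleton.elim _ _) hne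
    | succ b =>
      obtain ⟨A, hA, eA⟩ := I.exists_coset _ hne
      obtain ⟨A', hA', e₁, e₂⟩ := hA.lin.exists_inv
      have hA'e : I.act A' (f (snoc 0 1)) = snoc 0 1 := by rw [← eA, ← act_mul, e₁, act_one]
      have hadd := I.act_lin_add hA'
      let init : (Fin (b + 1) → ZMod 2) →+ (Fin b → ZMod 2) :=
        ⟨⟨fun w i => w (Fin.castAdd 1 i), rfl⟩, fun _ _ => rfl⟩
      let last : (Fin (b + 1) → ZMod 2) →+ ZMod 2 :=
        ⟨⟨fun w => w (Fin.natAdd b (0 : Fin 1)), rfl⟩, fun _ _ => rfl⟩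
      have hil : ∀ w, w = snoc (init w) (last w) := by
        intro w
        obtain ⟨v, x, rfl⟩ := exists_snoc w
        exact snoc_inj.2 ⟨funext fun i => (snoc_castAdd v x i).symm, (snoc_natAdd v x 0).symm⟩
      let f' : (Fin a → ZMod 2) →+ (Fin (b + 1) → ZMod 2) :=
        ⟨⟨fun v => I.act A' (f (snoc v 0)), by
          rw [snoc_zero, map_zero, I.act_lin_zero hA']⟩, fun v w => by
          show I.act A' (f (snoc (v + w) 0)) = _
          rw [← hadd, ← map_add, snoc_add, add_zero]⟩
      have hf' : ∀ v x, I.act A' (f (snoc v x)) = snoc (init (f' v)) (x + last (f' v)) := by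
        intro v x
        have hx := eq_zero_or_one x
        rcases hx with rfl | rfl
        · rw [zero_add, ← hil]; rfl
        · have : snoc v 1 = snoc 0 1 + snoc v 0 := by rw [snoc_add, zero_add, add_zero]
          rw [this, map_add, hadd, hA'e]
          show snoc 0 1 + f' v = _
          conv_lhs => rw [hil (f' v), snoc_add, zero_add]
      -- The upper block is injective: with `x = last (f' v)` the last coordinate of `hf'` becomes
      -- `0`, so equal initial parts give equal values of `f`.
      obtain ⟨w, hw, ew⟩ := ih (init.comp f') (by
        intro v v' h
        have h₁ := hf' v (last (f' v))
        have h₂ := hf' v' (last (f' v'))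
        have h' : init (f' v) = init (f' v') := h
        have hx : ∀ x : ZMod 2, x + x = 0 := by decide
        rw [hx, h'] at h₁
        rw [hx] at h₂
        exact (snoc_inj.1 (hf (I.act_injective _ (h₁.trans h₂.symm)))).1)
      obtain ⟨R, hR, eR⟩ := I.exists_row (last.comp f')
      refine ⟨R ⨾ P.lift w ⨾ A, (word_of_lin hR.lin).comp (hw.lift.comp (word_of_lin hA.lin)),
        fun v => ?_⟩
      obtain ⟨v, x, rfl⟩ := exists_snoc v
      rw [act_comp, act_comp, eR, act_lift, ew]
      show I.act A (snoc (init (f' v)) (x + last (f' v))) = _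
      rw [← hf', ← act_mul, e₂, act_one]

theorem exists_word {a b : ℕ} (f : MonoAffMat.Hom a b) :
    ∃ w, G.Word a b w ∧ I.toMor.map w = f := by
  have hinj := (isMono_iff f.1).1 f.2
  let l : (Fin a → ZMod 2) →+ (Fin b → ZMod 2) := f.1.lin.mulVecLin.toAddMonoidHom
  obtain ⟨w, hw, ew⟩ := I.exists_word_of_additive l (by
    intro v v' h
    refine hinj ?_
    exact congrArg (· + f.1.vec) h)
  obtain ⟨N, hN, eN⟩ := I.exists_nots f.1.vec
  refine ⟨_, hw.comp (word_of_nots hN), I.map_eq_iff.2 fun v => ?_⟩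
  rw [act_comp, eN, ew]
  rfl

end Gates.Interp

end PROP

/-! ### Props generated by gates -/

namespace PROP

variable {P : PROP}

namespace Gates

variable {G : P.Gates}

theorem Word.cast {a b a' b' : ℕ} {f : P.Hom a b} (hf : G.Word a b f) (ha : a = a') (hb : b = b') :
    G.Word a' b' (castHom ha hb f) := by
  subst ha; subst hb; exact hf

theorem Word.of_cast {a b a' b' : ℕ} {f : P.Hom a b} {ha : a = a'} {hb : b = b'}
    (hf : G.Word a' b' (castHom ha hb f)) : G.Word a b f := by
  subst ha; subst hb; exact hf

theorem Word.whisk (k : ℕ) {a b : ℕ} {f : P.Hom a b} (hf : G.Word a b f) :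
    G.Word (k + a) (k + b) (P.whisk k f) := by
  induction hf with
  | id a => rw [whisk_id]; exact Word.id _
  | comp _ _ ih ih' => rw [whisk_comp]; exact ih.comp ih'
  | sw m => exact whisk_add_two k m P.swap ▸ Word.sw (G := G) (k + m)
  | cn m => exact whisk_add_two k m G.c ▸ Word.cn (G := G) (k + m)
  | nt m => exact whisk_add_one k m G.n ▸ Word.nt (G := G) (k + m)
  | un m => exact whisk_add_unit k m G.u ▸ Word.un (G := G) (k + m)
  | lift _ ih => rw [← lift_whisk]; exact ih.lift

theorem Word.tensor_id {a b : ℕ} {f : P.Hom a b} (hf : G.Word a b f) (j : ℕ) :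
    G.Word (a + j) (b + j) (P.tensor f (P.id j)) := by
  induction j with
  | zero =>
    have : P.tensor f (P.id 0) = f := P.tensor_unit f
    exact this.symm ▸ hf
  | succ j ih =>
    have : P.lift (P.tensor f (P.id j)) = P.tensor f (P.id (j + 1)) :=
      (P.tensor_assoc f (P.id j) (P.id 1)).trans (congrArg (P.tensor f) (P.tensor_id j 1))
    rw [← this]
    exact ih.lift

theorem Word.tensor {a b c d : ℕ} {f : P.Hom a b} {g : P.Hom c d} (hf : G.Word a b f)
    (hg : G.Word c d g) : G.Word (a + c) (b + d) (P.tensor f g) := by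
  rw [tensor_eq_left]
  exact (hf.tensor_id c).comp (hg.whisk b)

theorem symm_one_succ (b : ℕ) : P.symm 1 (b + 1) = P.lift (P.symm 1 b) ⨾ P.whisk b P.swap :=
  P.hexagon 1 b 1

/-- The hexagon axiom splits only the second argument; the first is split by passing to inverses. -/
theorem symm_succ_one (b : ℕ) :
    P.symm (b + 1) 1 = P.whisk b P.swap ⨾ P.lift (P.symm b 1) := by
  have e : P.symm 1 (b + 1) ⨾ (P.whisk b P.swap ⨾ P.lift (P.symm b 1)) = P.id (1 + (b + 1)) := by
    rw [symm_one_succ]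
    have e₁ : P.whisk b P.swap ⨾ P.whisk b P.swap = P.id (b + 1 + 1) :=
      (whisk_comp b P.swap P.swap).symm.trans
        ((congrArg (P.whisk b) swap_swap).trans (whisk_id b 2))
    have e₂ : P.lift (P.symm 1 b) ⨾ P.lift (P.symm b 1) = P.id (1 + b + 1) := by
      rw [← lift_comp, P.symm_symm, lift_id]
    refine (P.assoc (P.lift (P.symm 1 b)) (P.whisk b P.swap) _).trans ?_
    refine (congrArg (P.comp (P.lift (P.symm 1 b)))
      (P.assoc (P.whisk b P.swap) (P.whisk b P.swap) (P.lift (P.symm b 1))).symm).trans ?_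
    refine (congrArg (fun t => P.comp (P.lift (P.symm 1 b)) (P.comp t (P.lift (P.symm b 1))))
      e₁).trans ?_
    refine (congrArg (P.comp (P.lift (P.symm 1 b))) (P.id_comp _)).trans e₂
  have h := congrArg (P.comp (P.symm (b + 1) 1)) e
  rw [← P.assoc, P.symm_symm, P.id_comp, P.comp_id] at h
  exact h.symm

theorem Word.symm_one (a : ℕ) : G.Word (a + 1) (1 + a) (P.symm a 1) := by
  induction a with
  | zero =>
    have e : P.symm 0 1 = P.id 1 := by
      have h : P.symm 1 0 ⨾ P.symm 0 1 = P.id 1 := P.symm_symm 1 0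
      rw [symm_one_zero] at h
      exact (P.id_comp _).symm.trans h
    exact e.symm ▸ Word.id 1
  | succ a ih =>
    rw [symm_succ_one]
    exact (Word.sw a).comp ih.lift

/-- Cancelling `symm a 0` in the hexagon for `a, 0, 0` shows that its padded copy is an identity, up
to transport along `0 + a = a`. -/
theorem Word.symm_zero (a : ℕ) : G.Word (a + 0) (0 + a) (P.symm a 0) := by
  have h := P.hexagon a 0 0
  have h₁ : P.tensor (P.symm a 0) (P.id 0) = P.symm a 0 := P.tensor_unit (P.symm a 0)
  have h₂ : ∀ y : P.Hom (0 + a) (0 + a), P.symm a 0 = P.symm a 0 ⨾ y → y = P.id (0 + a) := by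
    intro y hy
    have := congrArg (P.comp (P.symm 0 a)) hy
    rw [← P.assoc, P.symm_symm, P.id_comp] at this
    exact this.symm
  rw [h₁] at h
  have h₃ := h₂ _ h
  have w : G.Word (0 + a) (0 + a) (P.id (0 + a)) := Word.id _
  rw [← h₃] at w
  have w' := (Word.of_cast w).cast (Nat.zero_add (a + 0)) (Nat.zero_add (0 + a))
  rwa [P.unit_tensor] at w'

theorem Word.symm (a b : ℕ) : G.Word (a + b) (b + a) (P.symm a b) := by
  induction b with
  | zero => exact Word.symm_zero a
  | succ b ih =>
    have e : P.symm a (b + 1) = P.lift (P.symm a b) ⨾ _ := P.hexagon a b 1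
    rw [e]
    exact ih.lift.comp (((Word.symm_one a).whisk b).cast _ _)

theorem Word.c : G.Word 2 2 G.c := by
  have e : castHom (Nat.zero_add 2) (Nat.zero_add 2) (P.tensor (P.id 0) G.c) = G.c :=
    P.unit_tensor G.c
  exact e ▸ Word.cn (G := G) 0

theorem Word.n : G.Word 1 1 G.n := by
  have e : castHom (Nat.zero_add 1) (Nat.zero_add 1) (P.tensor (P.id 0) G.n) = G.n :=
    P.unit_tensor G.n
  exact e ▸ Word.nt (G := G) 0

theorem Word.u : G.Word 0 1 G.u := by
  have e : castHom (Nat.zero_add 0) (Nat.zero_add 1) (P.tensor (P.id 0) G.u) = G.u :=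
    P.unit_tensor G.u
  exact e ▸ Word.un (G := G) 0

theorem Word.eval {S : ℕ → ℕ → Type} {φ : ∀ {a b : ℕ}, S a b → P.Hom a b}
    (hφ : ∀ {a b : ℕ} (s : S a b), G.Word a b (φ s)) {a b : ℕ} (t : PropTerm S a b) :
    G.Word a b (t.eval P φ) := by
  induction t with
  | gen s => exact hφ s
  | id a => exact Word.id a
  | comp _ _ ih ih' => exact ih.comp ih'
  | tensor _ _ ih ih' => exact ih.tensor ih'
  | symm a b => exact Word.symm a b

/-- The interpretation of a prop generated by gates is an isomorphism. -/
noncomputable def Interp.iso (I : G.Interp)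
    (hw : ∀ {a b : ℕ} (f : P.Hom a b), G.Word a b f) : P ≅ MonoAffMat :=
  have inj : ∀ {a b : ℕ} {f g : P.Hom a b}, I.toMor.map f = I.toMor.map g → f = g :=
    fun {_ _ f g} h => I.word_ext (hw f) (hw g) fun v =>
      congrArg (fun t : MonoAffMat.Hom _ _ => t.1.app v) h
  have spec : ∀ {a b : ℕ} (f : MonoAffMat.Hom a b), I.toMor.map (I.exists_word f).choose = f :=
    fun f => (I.exists_word f).choose_spec.2
  { hom := I.toMor
    inv := Morphism.mk (fun f => (I.exists_word f).choose)
      (fun a => inj (by rw [spec, I.toMor.map_id]))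
      (fun f g => inj (by rw [spec, I.toMor.map_comp, spec, spec]))
      (fun f g => inj (by rw [spec, I.toMor.map_tensor, spec, spec]))
      (fun a b => inj (by rw [spec, I.toMor.map_symm]))
    hom_inv_id := hom_ext fun f => inj (spec (I.toMor.map f))
    inv_hom_id := hom_ext fun f => spec f }

end Gates

end PROP

/-! ### The gates of the pushout -/

theorem SMTheory.map_eqn (T : SMTheory) {Q : PROP} (F : T.prop ⟶ Q) {a b : ℕ}
    {s t : PropTerm T.Gen a b} (h : T.Eqn s t) :
    s.eval Q (fun g => F.map (T.ofTerm (PropTerm.gen g))) =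
      t.eval Q (fun g => F.map (T.ofTerm (PropTerm.gen g))) := by
  rw [← T.map_ofTerm F, ← T.map_ofTerm F, T.ofTerm_eq (SMTheory.Rel.eqn h)]

/-- The gates in a prop under `Mono(cb₂)` and `Iso(Affcb₂)`. -/
def PROP.Gates.ofCocone {Q : PROP} (F : MonoCb₂ ⟶ Q) (H : IsoAffCb₂ ⟶ Q)
    (h : isoCbToMonoCb ≫ F = isoCbToIsoAffCb ≫ H) : Q.Gates where
  c := F.map (monoCbTheory.ofTerm (PropTerm.gen (Sum.inl CNotGen.cnot)))
  u := F.map (monoCbTheory.ofTerm (PropTerm.gen (Sum.inr UnitGen.unit)))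
  n := H.map (isoAffCbTheory.ofTerm (PropTerm.gen (Sum.inr NotGen.not)))
  c_c := monoCbTheory.map_eqn F (SMTheory.ExtendEqn.old IsoCbEqn.one)
  dcd := monoCbTheory.map_eqn F (SMTheory.ExtendEqn.old IsoCbEqn.two)
  three := monoCbTheory.map_eqn F (SMTheory.ExtendEqn.old IsoCbEqn.three)
  four := monoCbTheory.map_eqn F (SMTheory.ExtendEqn.old IsoCbEqn.four)
  five := monoCbTheory.map_eqn F (SMTheory.ExtendEqn.old IsoCbEqn.five)
  u_c := monoCbTheory.map_eqn F (SMTheory.ExtendEqn.new MonoCbEqn.six)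
  n_n := isoAffCbTheory.map_eqn H (SMTheory.ExtendEqn.new IsoAffCbEqn.seven)
  n_c := by
    -- The controlled-not is taken through `F` and the not through `H`; commutativity of the square
    -- identifies the two images of the controlled-not.
    have e : F.map (monoCbTheory.ofTerm (PropTerm.gen (Sum.inl CNotGen.cnot))) =
        H.map (isoAffCbTheory.ofTerm (PropTerm.gen (Sum.inl CNotGen.cnot))) :=
      congrArg (fun K : IsoCb₂ ⟶ Q => K.map (isoCbTheory.ofTerm (PropTerm.gen CNotGen.cnot))) h
    rw [e]
    exact isoAffCbTheory.map_eqn H (SMTheory.ExtendEqn.new IsoAffCbEqn.eight)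
  c_n := by
    have e : F.map (monoCbTheory.ofTerm (PropTerm.gen (Sum.inl CNotGen.cnot))) =
        H.map (isoAffCbTheory.ofTerm (PropTerm.gen (Sum.inl CNotGen.cnot))) :=
      congrArg (fun K : IsoCb₂ ⟶ Q => K.map (isoCbTheory.ofTerm (PropTerm.gen CNotGen.cnot))) h
    rw [e]
    exact isoAffCbTheory.map_eqn H (SMTheory.ExtendEqn.new IsoAffCbEqn.nine)

/-! ### The isomorphism -/

theorem isoCb_interp :
    isoCbToMonoCb ≫ monoCbInterp = isoCbToIsoAffCb ≫ isoAffCbInterp := by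
  apply SMTheory.prop_hom_ext
  rintro a b ⟨⟩
  rfl

/-- In the explicit pushout every map is a class of terms, so that induction shows it to be a word
of gates. -/
theorem exists_iso_of_isPushout_pushoutTheory :
    ∃ e : (PROP.pushoutTheory isoCbToMonoCb isoCbToIsoAffCb).prop ≅ MonoAffMat,
      PROP.pushoutInl isoCbToMonoCb isoCbToIsoAffCb ≫ e.hom = monoCbInterp ∧
      PROP.pushoutInr isoCbToMonoCb isoCbToIsoAffCb ≫ e.hom = isoAffCbInterp := by
  have hp := PROP.isPushout_pushoutTheory isoCbToMonoCb isoCbToIsoAffCb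
  let G := PROP.Gates.ofCocone _ _ hp.w
  have hl := hp.inl_desc monoCbInterp isoAffCbInterp isoCb_interp
  have hr := hp.inr_desc monoCbInterp isoAffCbInterp isoCb_interp
  let I : G.Interp :=
    { toMor := hp.desc monoCbInterp isoAffCbInterp isoCb_interp
      map_c := congrArg (fun K : MonoCb₂ ⟶ MonoAffMat =>
        (K.map (monoCbTheory.ofTerm (PropTerm.gen (Sum.inl CNotGen.cnot)))).1) hl
      map_u := congrArg (fun K : MonoCb₂ ⟶ MonoAffMat =>
        (K.map (monoCbTheory.ofTerm (PropTerm.gen (Sum.inr UnitGen.unit)))).1) hl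
      map_n := congrArg (fun K : IsoAffCb₂ ⟶ MonoAffMat =>
        (K.map (isoAffCbTheory.ofTerm (PropTerm.gen (Sum.inr NotGen.not)))).1) hr }
  have hc : (PROP.pushoutInr isoCbToMonoCb isoCbToIsoAffCb).map
      (isoAffCbTheory.ofTerm (PropTerm.gen (Sum.inl CNotGen.cnot))) = G.c :=
    (congrArg (fun K : IsoCb₂ ⟶ (PROP.pushoutTheory isoCbToMonoCb isoCbToIsoAffCb).prop =>
      K.map (isoCbTheory.ofTerm (PropTerm.gen CNotGen.cnot))) hp.w).symm
  refine ⟨I.iso ?_, hl, hr⟩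
  rintro a b ⟨t⟩
  have e := SMTheory.eval_gen (PROP.pushoutTheory isoCbToMonoCb isoCbToIsoAffCb) t
  suffices h : G.Word a b (t.eval (PROP.pushoutTheory isoCbToMonoCb isoCbToIsoAffCb).prop
      fun g => (PROP.pushoutTheory isoCbToMonoCb isoCbToIsoAffCb).ofTerm (PropTerm.gen g)) by
    rw [e] at h
    exact h
  refine PROP.Gates.Word.eval ?_ t
  -- The generators of the pushout are maps of the two props, hence themselves classes of terms; a
  -- second induction reaches the gates.
  rintro a b (⟨⟨t⟩⟩ | ⟨⟨t⟩⟩)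
  · have e := monoCbTheory.map_ofTerm (PROP.pushoutInl isoCbToMonoCb isoCbToIsoAffCb) t
    refine (congrArg (G.Word a b) e).mpr (PROP.Gates.Word.eval ?_ t)
    rintro a b (g | g) <;> cases g
    · exact PROP.Gates.Word.c (G := G)
    · exact PROP.Gates.Word.u (G := G)
  · have e := isoAffCbTheory.map_ofTerm (PROP.pushoutInr isoCbToMonoCb isoCbToIsoAffCb) t
    refine (congrArg (G.Word a b) e).mpr (PROP.Gates.Word.eval ?_ t)
    rintro a b (g | g) <;> cases g
    · exact hc ▸ PROP.Gates.Word.c (G := G)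
    · exact PROP.Gates.Word.n (G := G)

theorem mainTheorem10 :
    ∃ e : MonoAffCb₂ ≅ MonoAffMat,
      monoCbToMonoAffCb ≫ e.hom = monoCbInterp ∧
      isoAffCbToMonoAffCb ≫ e.hom = isoAffCbInterp := by
  obtain ⟨e, hl, hr⟩ := exists_iso_of_isPushout_pushoutTheory
  have hp := PROP.isPushout_pushoutTheory isoCbToMonoCb isoCbToIsoAffCb
  refine ⟨hp.isoPushout.symm ≪≫ e, ?_, ?_⟩
  · exact (Category.assoc _ _ _).symm.trans
      ((congrArg (· ≫ e.hom) hp.inl_isoPushout_inv).trans hl)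
  · exact (Category.assoc _ _ _).symm.trans
      ((congrArg (· ≫ e.hom) hp.inr_isoPushout_inv).trans hr)
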